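/- Let $k$ be a field, $[m]=\{1,\dots,m\}$ and $k[x]=k[x_1,\dots,x_m]$ with its $\mathbb N^m$-grading. A simplicial complex $K$ on $[m]$ is a family of subsets of $[m]$ closed under passing to subsets (elements of $[m]$ need not be vertices, and the void family is allowed); $k(K)=k[x]/I_K$ is its face ring, where $I_K$ is generated by the monomials $x^\tau=\prod_{j\in\tau}x_j$ with $\tau\subset[m]$, $\tau\notin K$. A finite sequence $P=(\sigma_1,\dots,\sigma_n)$ of subsets of $[m]$ (repetitions allowed) is a simplicial complement of $K$ if $(x^{\sigma_1},\dots,x^{\sigma_n})=I_K$; when $K$ is not void this forces all $\sigma_i$ to be non-empty. For $\omega\subset[m]$ put $$E_\omega P=(\sigma_1\setminus\omega,\dots,\sigma_n\setminus\omega),\quad \mathrm{star}_K\omega=\{\tau\in K\mid \omega\cup\tau\in K\},\quad \mathrm{link}_K\omega=\{\tau\in K\mid \omega\cup\tau\in K,\ \omega\cap\tau=\emptyset\}.$$ For a sequence $P$ of subsets of $[m]$, $\bar\Lambda^{s}(P)$ is the $k$-vector space with basis the symbols $\sigma_{i_1}\bar\wedge\cdots\bar\wedge\sigma_{i_s}$,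 $i_1<\dots<i_s$ (the unit $1$, with empty union, for $s=0$), with differential $$d(\sigma_{i_1}\bar\wedge\cdots\bar\wedge\sigma_{i_s})=\sum_u(-1)^u\,\sigma_{i_1}\bar\wedge\cdots\bar\wedge\widehat{\sigma_{i_u}}\bar\wedge\cdots\bar\wedge\sigma_{i_s},$$ the sum being over those $u$ for which omitting $\sigma_{i_u}$ does not change the union $\sigma_{i_1}\cup\dots\cup\sigma_{i_s}$; $\bar\Lambda^{*,\sigma}(P)$ is the subcomplex spanned by the symbols with union $\sigma$, and $H_i(\bar\Lambda^{*,\sigma}(P),d)$ is its homology in degree $i$. **Theorem 2.9.** Let $P$ be a simplicial complement of $K$. Then for every $\omega\subset[m]$: 1. $E_\omega P$ is a simplicial complement of $\mathrm{star}_K\omega$; if $\omega\in K$, all its members are non-empty. 2. For every $i\ge 0$ and every $\sigma\subset[m]$ there is an isomorphism of $k$-vector spaces $$H_{i}(\bar\Lambda^{*,\sigma}(E_\omega P),d)\cong \mathrm{Tor}^{k[x]}_{i,\sigma}(k(\mathrm{star}_K\omega),k),$$ where $\mathrm{Tor}_{i,\sigma}$ is the part of $H_i(F\otimes_{k[x]}k)$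 in the multidegree of the $0/1$-vector of $\sigma$, for any $\mathbb N^m$-graded free resolution $F$ of $k(\mathrm{star}_K\omega)$ over $k[x]$. 3. For every $q\ge 0$ there is an isomorphism of $k$-vector spaces $$H_{q}(\bar\Lambda^{*,[m]\setminus\omega}(E_\omega P),d)\cong\widetilde H^{\,m-|\omega|-q-1}(\mathrm{link}_K\omega;k),$$ the reduced simplicial cohomology, in which the empty face is a simplex of dimension $-1$ (so $\widetilde H^{-1}(\{\emptyset\};k)=k$, and all groups of the void complex vanish). -/

import Mathlib

universe u v

namespace SimplicialComplement

open scoped TensorProduct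

noncomputable section

/-! ### Simplicial complexes, stars and links -/

/-- A simplicial complex on the vertex set `[m]`: a set of subsets of `[m]` closed under passing to
subsets. Vertices need not be faces. The void complex, with no face at all, is allowed, and it is
different from the complex whose only face is the empty set. -/
abbrev SComplex (m : ℕ) : Type := LowerSet (Finset (Fin m))

/-- `star_K ω = {τ ∈ K | ω ∪ τ ∈ K}`; it is void when `ω` is not a face of `K`. -/
def star {m : ℕ} (K : SComplex m) (ω : Finset (Fin m)) : SComplex m where
  carrier := {τ | τ ∈ K ∧ ω ∪ τ ∈ K}
  lower' := fun _ _ hba ha =>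
    ⟨K.lower hba ha.1, K.lower (Finset.union_subset_union_right hba) ha.2⟩

/-- `link_K ω = {τ ∈ K | ω ∪ τ ∈ K, ω ∩ τ = ∅}`. -/
def link {m : ℕ} (K : SComplex m) (ω : Finset (Fin m)) : SComplex m where
  carrier := {τ | τ ∈ K ∧ ω ∪ τ ∈ K ∧ Disjoint ω τ}
  lower' := fun _ _ hba ha =>
    ⟨K.lower hba ha.1, K.lower (Finset.union_subset_union_right hba) ha.2.1,
      ha.2.2.mono_right hba⟩

/-! ### Simplicial complements and compression -/

/-- The 0/1 vector in `ℕ^m` of a subset of `[m]`. -/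
def expVec {m : ℕ} (σ : Finset (Fin m)) : Fin m →₀ ℕ := ∑ i ∈ σ, Finsupp.single i 1

/-- The ideal of `k[x_1, …, x_m]` generated by the squarefree monomials `x^{σ_1}, …, x^{σ_n}` of a
sequence `P = (σ_1, …, σ_n)` of subsets of `[m]` (repetitions allowed). -/
def monomialIdeal (k : Type u) [Field k] {m n : ℕ} (P : Fin n → Finset (Fin m)) :
    Ideal (MvPolynomial (Fin m) k) :=
  Ideal.span (Set.range fun j => MvPolynomial.monomial (expVec (P j)) (1 : k))

/-- The Stanley-Reisner ideal of `K`, generated by the monomials of the non-faces of `K`. -/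
def stanleyReisnerIdeal (k : Type u) [Field k] {m : ℕ} (K : SComplex m) :
    Ideal (MvPolynomial (Fin m) k) :=
  Ideal.span ((fun τ => MvPolynomial.monomial (expVec τ) (1 : k)) '' {τ | τ ∉ K})

/-- The Stanley-Reisner face ring `k(K)`. -/
abbrev FaceRing (k : Type u) [Field k] {m : ℕ} (K : SComplex m) : Type u :=
  MvPolynomial (Fin m) k ⧸ stanleyReisnerIdeal k K

/-- The sequence `P` is a simplicial complement of `K`: the ideal of `P` is the Stanley-Reisner
ideal of `K`. If `K` is not void, this ideal is proper, so every member of `P` is non-empty; for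
the void complex the ideal is the unit ideal and some member of `P` is empty. -/
def IsSimplicialComplement (k : Type u) [Field k] {m n : ℕ} (P : Fin n → Finset (Fin m))
    (K : SComplex m) : Prop :=
  monomialIdeal k P = stanleyReisnerIdeal k K

/-- The `ω`-compression `E_ω P = (σ_1 \ ω, …, σ_n \ ω)`. -/
def compression {m n : ℕ} (ω : Finset (Fin m)) (P : Fin n → Finset (Fin m)) :
    Fin n → Finset (Fin m) :=
  fun j => P j \ ω

/-! ### The complex of a simplicial complement -/

/-- The quotient `Z / (B ∩ Z)`; for boundaries `B ≤ Z` among cycles `Z` this is `Z / B`. -/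
abbrev Subquotient {k : Type*} {V : Type*} [Field k] [AddCommGroup V] [Module k V]
    (Z B : Submodule k V) : Type _ :=
  Z ⧸ B.submoduleOf Z

/-- The union `σ_{i_1} ∪ ⋯ ∪ σ_{i_s}` for `S = {i_1 < ⋯ < i_s}`. -/
def unionOf {m n : ℕ} (P : Fin n → Finset (Fin m)) (S : Finset (Fin n)) : Finset (Fin m) :=
  S.biUnion P

/-- The differential of `Λ̄(P)`. As a vector space `Λ̄(P)` has the basis
`σ_{i_1} ∧ ⋯ ∧ σ_{i_s}`, `i_1 < ⋯ < i_s`, that is, one basis vector for every subset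
`S = {i_1 < ⋯ < i_s}` of the index set (the empty set gives the unit). The differential sends it to
`∑_u (-1)^u σ_{i_1} ∧ ⋯ (omit σ_{i_u}) ⋯ ∧ σ_{i_s}`, summed over those `u` for which the omission
does not change the union. Here `u` is the number of elements of `S` that are at most `i_u`. -/
def lambdaD (k : Type u) [Field k] {m n : ℕ} (P : Fin n → Finset (Fin m)) :
    (Finset (Fin n) →₀ k) →ₗ[k] (Finset (Fin n) →₀ k) :=
  Finsupp.linearCombination k fun S =>
    ∑ i ∈ S with unionOf P (S.erase i) = unionOf P S,
      Finsupp.single (S.erase i) ((-1 : k) ^ (S.filter (· ≤ i)).card)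

/-- `Λ̄^{s,σ}(P)`: the span of the `σ_{i_1} ∧ ⋯ ∧ σ_{i_s}` with union `σ`. -/
def lambdaPiece (k : Type u) [Field k] {m n : ℕ} (P : Fin n → Finset (Fin m)) (s : ℕ)
    (σ : Finset (Fin m)) : Submodule k (Finset (Fin n) →₀ k) :=
  Finsupp.supported k k {S | S.card = s ∧ unionOf P S = σ}

/-- `H_{s,σ}`: the homology of the complex `(Λ̄^{*,σ}(P), d)` in degree `s`. -/
abbrev LambdaHomology (k : Type u) [Field k] {m n : ℕ} (P : Fin n → Finset (Fin m)) (s : ℕ)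
    (σ : Finset (Fin m)) : Type u :=
  Subquotient (lambdaPiece k P s σ ⊓ LinearMap.ker (lambdaD k P))
    ((lambdaPiece k P (s + 1) σ).map (lambdaD k P))

/-! ### Reduced simplicial cohomology -/

/-- The simplicial coboundary on functions on all faces of `K`, the empty face included:
`(δ f)(τ) = ∑_j (-1)^j f(τ \ {v_j})` for `τ = {v_0 < ⋯ < v_p}`. -/
def coboundary (k : Type u) [Field k] {m : ℕ} (K : SComplex m) :
    ({τ : Finset (Fin m) // τ ∈ K} → k) →ₗ[k] ({τ : Finset (Fin m) // τ ∈ K} → k) where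
  toFun f := fun τ => ∑ w ∈ τ.1, (-1 : k) ^ (τ.1.filter (· < w)).card *
    f ⟨τ.1.erase w, K.lower (Finset.erase_subset w τ.1) τ.2⟩
  map_add' f g := by
    funext τ
    simp [mul_add, Finset.sum_add_distrib]
  map_smul' c f := by
    funext τ
    simp [Finset.mul_sum, mul_left_comm]

/-- The cochains of degree `p`: functions on the faces with `p + 1` vertices, extended by zero. -/
def cochains (k : Type u) [Field k] {m : ℕ} (K : SComplex m) (p : ℤ) :
    Submodule k ({τ : Finset (Fin m) // τ ∈ K} → k) where
  carrier := {f | ∀ τ, (τ.1.card : ℤ) ≠ p + 1 → f τ = 0}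
  add_mem' hf hg := fun τ h => by simp [hf τ h, hg τ h]
  zero_mem' := fun _ _ => rfl
  smul_mem' c _ hf := fun τ h => by simp [hf τ h]

/-- The reduced simplicial cohomology `H̃^p(K; k)`, `p ∈ ℤ`. -/
abbrev ReducedCohomology (k : Type u) [Field k] {m : ℕ} (K : SComplex m) (p : ℤ) : Type u :=
  Subquotient (cochains k K p ⊓ LinearMap.ker (coboundary k K))
    ((cochains k K (p - 1)).map (coboundary k K))

/-! ### The multigraded Tor of a face ring and the field -/

/-- The part of degree `a ∈ ℕ^m` of the free `k[x]`-module on a set `B` of generators, where the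
generator `b` has degree `deg b`. -/
def freePiece (k : Type u) [Field k] {m : ℕ} {B : Type v} (deg : B → Fin m →₀ ℕ)
    (a : Fin m →₀ ℕ) : Submodule k (B →₀ MvPolynomial (Fin m) k) where
  carrier := {w | ∀ b e, MvPolynomial.coeff e (w b) ≠ 0 → deg b + e = a}
  add_mem' {w w'} hw hw' := fun b e h => by
    by_cases h1 : MvPolynomial.coeff e (w b) = 0
    · refine hw' b e fun h2 => h ?_
      simp [h1, h2]
    · exact hw b e h1
  zero_mem' := fun b e h => by simp at h
  smul_mem' c w hw := fun b e h => hw b e fun h1 => h (by simp [h1])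

/-- The part of degree `a ∈ ℕ^m` of the face ring: the line spanned by the class of `x^a`. -/
def facePiece (k : Type u) [Field k] {m : ℕ} (K : SComplex m) (a : Fin m →₀ ℕ) :
    Submodule k (FaceRing k K) :=
  Submodule.span k {Ideal.Quotient.mk (stanleyReisnerIdeal k K) (MvPolynomial.monomial a 1)}

/-- An `ℕ^m`-graded free resolution `⋯ → F_1 → F_0 → k(K) → 0` of the face ring over `k[x]`:
`F_s` is free on homogeneous generators `B s` of degrees `deg s`, and all maps preserve degrees. -/
structure GradedFreeResolution (k : Type u) [Field k] {m : ℕ} (K : SComplex m) where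
  B : ℕ → Type v
  deg : ∀ s, B s → Fin m →₀ ℕ
  d : ∀ s, (B (s + 1) →₀ MvPolynomial (Fin m) k) →ₗ[MvPolynomial (Fin m) k]
    (B s →₀ MvPolynomial (Fin m) k)
  aug : (B 0 →₀ MvPolynomial (Fin m) k) →ₗ[MvPolynomial (Fin m) k] FaceRing k K
  d_homogeneous : ∀ s b, d s (Finsupp.single b 1) ∈ freePiece k (deg s) (deg (s + 1) b)
  aug_homogeneous : ∀ b, aug (Finsupp.single b 1) ∈ facePiece k K (deg 0 b)
  aug_surjective : Function.Surjective aug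
  exact_zero : LinearMap.range (d 0) = LinearMap.ker aug
  exact_succ : ∀ s, LinearMap.range (d (s + 1)) = LinearMap.ker (d s)

/-- The field `k` as the `k[x]`-module `k[x]/(x_1, …, x_m)`, concentrated in degree `0`. -/
abbrev TrivialModule (k : Type u) [Field k] (m : ℕ) : Type u :=
  MvPolynomial (Fin m) k ⧸
    (Ideal.span (Set.range MvPolynomial.X) : Ideal (MvPolynomial (Fin m) k))

namespace GradedFreeResolution

variable {k : Type u} [Field k] {m : ℕ} {K : SComplex m} (F : GradedFreeResolution.{u, v} k K)

/-- The module `F_s ⊗ k` over `k[x]`. -/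
abbrev Tensored (s : ℕ) : Type (max u v) :=
  (F.B s →₀ MvPolynomial (Fin m) k) ⊗[MvPolynomial (Fin m) k] TrivialModule k m

/-- The differential `d ⊗ 1 : F_{s+1} ⊗ k → F_s ⊗ k`. -/
def tensoredD (s : ℕ) : F.Tensored (s + 1) →ₗ[k] F.Tensored s :=
  ((F.d s).rTensor (TrivialModule k m)).restrictScalars k

/-- The part of degree `a` of `F_s ⊗ k`. -/
def tensoredPiece (s : ℕ) (a : Fin m →₀ ℕ) : Submodule k (F.Tensored s) :=
  Submodule.span k {t | ∃ w ∈ freePiece k (F.deg s) a, t = w ⊗ₜ 1}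

/-- The cycles of degree `a` in `F_i ⊗ k`. -/
def torCycles : ∀ (i : ℕ) (_ : Fin m →₀ ℕ), Submodule k (F.Tensored i)
  | 0, a => F.tensoredPiece 0 a
  | i + 1, a => F.tensoredPiece (i + 1) a ⊓ LinearMap.ker (F.tensoredD i)

/-- The boundaries of degree `a` in `F_i ⊗ k`. -/
def torBoundaries (i : ℕ) (a : Fin m →₀ ℕ) : Submodule k (F.Tensored i) :=
  (F.tensoredPiece (i + 1) a).map (F.tensoredD i)

/-- `Tor_{i,a}^{k[x]}(k(K), k)`, computed from the resolution `F`: the part of degree `a` of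
`H_i(F ⊗ k)`. -/
abbrev Tor (i : ℕ) (a : Fin m →₀ ℕ) : Type (max u v) :=
  Subquotient (k := k) (V := F.Tensored i) (F.torCycles i a) (F.torBoundaries i a)

end GradedFreeResolution

/-! ### Graded free resolutions exist -/

section Existence

variable {k : Type u} [Field k] {m : ℕ}

theorem iSup_freePiece {B : Type v} (deg : B → Fin m →₀ ℕ) :
    ⨆ a, freePiece k deg a = ⊤ := by
  rw [eq_top_iff]
  rintro w -
  induction w using Finsupp.induction_linear with
  | zero => exact zero_mem _
  | add f g hf hg => exact add_mem hf hg
  | single b p =>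
    induction p using MvPolynomial.induction_on' with
    | monomial e c =>
      refine Submodule.mem_iSup_of_mem (deg b + e) ?_
      intro b' e' h
      classical
      by_cases hb : b = b'
      · subst hb
        simp only [Finsupp.single_eq_same, MvPolynomial.coeff_monomial] at h
        by_cases he : e = e'
        · rw [he]
        · simp [he] at h
      · simp [hb] at h
    | add p q hp hq => rw [Finsupp.single_add]; exact add_mem hp hq

theorem eq_zero_of_sum_freePiece {B : Type v} (deg : B → Fin m →₀ ℕ)
    {ι : Finset (Fin m →₀ ℕ)} (g : (Fin m →₀ ℕ) → B →₀ MvPolynomial (Fin m) k)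
    (hg : ∀ a, g a ∈ freePiece k deg a) (h0 : ∑ a ∈ ι, g a = 0) {a : Fin m →₀ ℕ} (ha : a ∈ ι) :
    g a = 0 := by
  ext b e
  by_contra hne
  have hdeg : deg b + e = a := hg a b e hne
  have h1 : MvPolynomial.coeff e ((∑ a ∈ ι, g a) b) = 0 := by simp [h0]
  rw [Finsupp.finsetSum_apply, MvPolynomial.coeff_sum, Finset.sum_eq_single a] at h1
  · exact hne (by simpa using h1)
  · intro a' _ hne'
    by_contra h2
    exact hne' ((hg a' b e h2).symm.trans hdeg)
  · exact fun h => absurd ha h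

/-- A graded submodule of a graded free module: it is generated by homogeneous elements. -/
structure Stage (k : Type u) [Field k] (m : ℕ) where
  B : Type u
  deg : B → Fin m →₀ ℕ
  N : Submodule (MvPolynomial (Fin m) k) (B →₀ MvPolynomial (Fin m) k)
  le_span : N ≤ Submodule.span _ {w | w ∈ N ∧ ∃ a, w ∈ freePiece k deg a}

/-- All homogeneous elements of the submodule. -/
def Stage.Gen (S : Stage k m) : Type u :=
  {p : (Fin m →₀ ℕ) × (S.B →₀ MvPolynomial (Fin m) k) //
    p.2 ∈ S.N ∧ p.2 ∈ freePiece k S.deg p.1}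

/-- The canonical map from the free module on all homogeneous elements. -/
def Stage.map (S : Stage k m) :
    (S.Gen →₀ MvPolynomial (Fin m) k) →ₗ[MvPolynomial (Fin m) k]
      (S.B →₀ MvPolynomial (Fin m) k) :=
  Finsupp.linearCombination _ fun p => p.1.2

theorem Stage.range_map (S : Stage k m) : LinearMap.range S.map = S.N := by
  apply le_antisymm
  · rw [Stage.map, Finsupp.range_linearCombination, Submodule.span_le]
    rintro _ ⟨p, rfl⟩
    exact p.2.1
  · refine S.le_span.trans ?_
    rw [Stage.map, Finsupp.range_linearCombination]
    refine Submodule.span_mono ?_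
    rintro w ⟨hw, a, ha⟩
    exact ⟨⟨(a, w), hw, ha⟩, rfl⟩

theorem Stage.map_mem (S : Stage k m) (a : Fin m →₀ ℕ)
    (w : S.Gen →₀ MvPolynomial (Fin m) k) (hw : w ∈ freePiece k (fun p : S.Gen => p.1.1) a) :
    S.map w ∈ freePiece k S.deg a := by
  rw [Stage.map, Finsupp.linearCombination_apply, Finsupp.sum]
  refine Submodule.sum_mem _ fun p _ b e h => ?_
  rw [Finsupp.smul_apply, smul_eq_mul, MvPolynomial.coeff_mul] at h
  obtain ⟨⟨e1, e2⟩, he, hne⟩ := Finset.exists_ne_zero_of_sum_ne_zero h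
  replace he : e1 + e2 = e := Finset.HasAntidiagonal.mem_antidiagonal.1 he
  have h1 := hw p e1 (left_ne_zero_of_mul hne)
  have h2 := p.2.2 b e2 (right_ne_zero_of_mul hne)
  simp only at h1 h2
  rw [← he, ← h1, ← h2]
  abel

theorem Stage.map_single_mem (S : Stage k m) (b : S.Gen) :
    S.map (Finsupp.single b 1) ∈ freePiece k S.deg b.1.1 := by
  have h : S.map (Finsupp.single b 1) = b.1.2 := by
    rw [Stage.map, Finsupp.linearCombination_single, one_smul]
  rw [h]
  exact b.2.2

/-- The next syzygy module. -/
def Stage.next (S : Stage k m) : Stage k m where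
  B := S.Gen
  deg := fun p => p.1.1
  N := LinearMap.ker S.map
  le_span := by
    intro w hw
    have htop : w ∈ ⨆ a, freePiece k (fun p : S.Gen => p.1.1) a := by
      rw [iSup_freePiece]; trivial
    obtain ⟨f, hf, rfl⟩ := (Submodule.mem_iSup_iff_exists_finsupp _ _).1 htop
    refine Submodule.sum_mem _ fun a ha => Submodule.subset_span ⟨?_, a, hf a⟩
    refine eq_zero_of_sum_freePiece S.deg (fun a => S.map (f a))
      (fun a => S.map_mem a _ (hf a)) ?_ ha
    rw [← map_sum]
    exact hw

/-- The presentation of the face ring as a quotient of `k[x]`. -/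
def augmentation (k : Type u) [Field k] (K : SComplex m) :
    (PUnit.{u + 1} →₀ MvPolynomial (Fin m) k) →ₗ[MvPolynomial (Fin m) k] FaceRing k K :=
  (stanleyReisnerIdeal k K).mkQ ∘ₗ Finsupp.lapply PUnit.unit

/-- The first stage: the Stanley-Reisner ideal inside `k[x]`. -/
def initialStage (k : Type u) [Field k] (K : SComplex m) : Stage k m where
  B := PUnit
  deg := fun _ => 0
  N := LinearMap.ker (augmentation k K)
  le_span := by
    intro w hw
    have hw' : w PUnit.unit ∈ stanleyReisnerIdeal k K := by
      simpa [augmentation, Ideal.Quotient.eq_zero_iff_mem] using hw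
    have key : ∀ p ∈ stanleyReisnerIdeal k K,
        (Finsupp.single PUnit.unit p : PUnit.{u + 1} →₀ MvPolynomial (Fin m) k) ∈
          Submodule.span (MvPolynomial (Fin m) k)
          {w | w ∈ LinearMap.ker (augmentation k K) ∧
            ∃ a, w ∈ freePiece k (fun _ : PUnit.{u + 1} => (0 : Fin m →₀ ℕ)) a} := by
      intro p hp
      induction hp using Submodule.span_induction with
      | mem x hx =>
        refine Submodule.subset_span ⟨?_, ?_⟩
        · have : x ∈ stanleyReisnerIdeal k K := Submodule.subset_span hx
          simpa [augmentation, Ideal.Quotient.eq_zero_iff_mem] using this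
        · obtain ⟨τ, _, rfl⟩ := hx
          refine ⟨expVec τ, fun b e h => ?_⟩
          classical
          simp only [Finsupp.single_eq_same, MvPolynomial.coeff_monomial] at h
          by_contra hne
          exact h (if_neg fun h' => hne (by simp [h']))
      | zero => simp
      | add x y _ _ hx hy => rw [Finsupp.single_add]; exact add_mem hx hy
      | smul c x _ hx =>
        rw [← Finsupp.smul_single]; exact Submodule.smul_mem _ c hx
    have := key _ hw'
    rwa [show (Finsupp.single PUnit.unit (w PUnit.unit) : PUnit.{u + 1} →₀ _) = w by
      ext; simp] at this

/-- The successive syzygy modules of the face ring. -/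
def stages (k : Type u) [Field k] (K : SComplex m) : ℕ → Stage k m
  | 0 => initialStage k K
  | s + 1 => (stages k K s).next

theorem nonempty_gradedFreeResolution (k : Type u) [Field k] (K : SComplex m) :
    Nonempty (GradedFreeResolution.{u, u} k K) :=
  ⟨{ B := fun s => (stages k K s).B
     deg := fun s => (stages k K s).deg
     d := fun s => (stages k K s).map
     aug := augmentation k K
     d_homogeneous := fun s b => (stages k K s).map_single_mem b
     aug_homogeneous := fun b => Submodule.subset_span (by
      rw [show b = PUnit.unit from rfl]
      change augmentation k K (Finsupp.single PUnit.unit 1) =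
        Ideal.Quotient.mk _ (MvPolynomial.monomial 0 1)
      simp [augmentation])
     aug_surjective := fun y => by
      obtain ⟨p, rfl⟩ := Ideal.Quotient.mk_surjective y
      refine ⟨Finsupp.single PUnit.unit p, ?_⟩
      change (stanleyReisnerIdeal k K).mkQ ((Finsupp.single PUnit.unit p) PUnit.unit) = _
      rw [Finsupp.single_eq_same]
      rfl
     exact_zero := (stages k K 0).range_map
     exact_succ := fun s => (stages k K (s + 1)).range_map }⟩

end Existence

end

end SimplicialComplement

/-!
# Stars, links and compressed simplicial complements

Both `Λ̄^{*,σ}(P)` and the degree `σ` part of `F ⊗ k` compute the reduced cohomology of the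
restriction of `K` to `σ` (Hochster's formula), and both follow from one double complex argument.

The squarefree strands of a multigraded resolution of the face ring, with all variables set to
`1`, form one complex `W` filtered by subcomplexes `W_τ`, `τ ⊆ [m]`, where `W_τ` is a resolution
of `k` if `τ` is a face and is exact otherwise (`FilteredResolution`). In `⨁_{τ ⊆ σ} W_τ`, with
the simplicial coboundary in the direction of `τ` as second differential, every row `τ` can be
replaced by its homology, which leaves the cochains of `K` restricted to `σ`. The other direction
is a Koszul complex: a basis vector that already lies in a smaller `W_τ` can be contracted away,
which leaves the quotient of `W_σ` by all smaller `W_τ` (`FilteredResolution.Top`). Hence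
`Top.nonempty_homology_equiv_reducedCohomology`.

This applies to the exterior algebra on the members of a simplicial complement
(`taylorResolution`), where the top quotient is `Λ̄^{*,σ}(P)`, and to an arbitrary graded free
resolution `F` (`GradedFreeResolution.filteredResolution`), where the top quotient is the degree
`σ` part of `F ⊗ k`, because modulo the variables only the generators of degree exactly `σ`
survive. The first two claims of the theorem need in addition that `P` is a simplicial complement
of `K` exactly when the non-faces are the sets containing some `P j`
(`isSimplicialComplement_iff`). The last claim is the case `σ = [m] \ ω`, where the restriction of
the star is the link (`restriction_star`).
-/

namespace SimplicialComplement

open scoped TensorProduct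

noncomputable section

/-! ### Creation and annihilation operators on functions of finite sets -/

section Operators

variable (k : Type*) [Field k] {α : Type*} [LinearOrder α] {M : Type*} [AddCommGroup M]
  [Module k M]

/-- The sign `(-1)^u`, where `u` is the number of elements of `τ` below `v`. -/
def faceSign (τ : Finset α) (v : α) : k := (-1) ^ (τ.filter (· < v)).card

theorem faceSign_mul_self (τ : Finset α) (v : α) : faceSign k τ v * faceSign k τ v = 1 := by
  rw [faceSign, ← mul_pow]; simp

theorem faceSign_insert_self (τ : Finset α) (v : α) :
    faceSign k (insert v τ) v = faceSign k τ v := by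
  simp [faceSign, Finset.filter_insert]

theorem faceSign_erase_self (τ : Finset α) (v : α) :
    faceSign k (τ.erase v) v = faceSign k τ v := by
  rw [faceSign, faceSign, Finset.filter_erase, Finset.erase_eq_of_notMem (by simp)]

theorem faceSign_insert {τ : Finset α} {v w : α} (hw : w ∉ τ) :
    faceSign k (insert w τ) v = (if w < v then -1 else 1) * faceSign k τ v := by
  rw [faceSign, Finset.filter_insert]
  split_ifs with h
  · rw [Finset.card_insert_of_notMem (by simp [hw]), pow_succ, faceSign]; ring
  · rw [one_mul, faceSign]

theorem faceSign_erase {τ : Finset α} {v w : α} (hw : w ∈ τ) :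
    faceSign k (τ.erase w) v = (if w < v then -1 else 1) * faceSign k τ v := by
  have h := faceSign_insert k (v := v) (Finset.notMem_erase w τ)
  rw [Finset.insert_erase hw] at h
  rw [h]
  split_ifs <;> ring

variable {k}

/-- Exterior multiplication by `v`, on functions of finite sets: the term of the simplicial
coboundary that omits the vertex `v`. -/
def create (v : α) : (Finset α → M) →ₗ[k] (Finset α → M) where
  toFun f := fun τ => if v ∈ τ then faceSign k τ v • f (τ.erase v) else 0
  map_add' f g := by
    funext τ; by_cases h : v ∈ τ <;> simp [h]
  map_smul' c f := by
    funext τ; by_cases h : v ∈ τ <;> simp [h, smul_comm c]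

/-- Contraction with `v`, on functions of finite sets: the term of the simplicial boundary that
adds the vertex `v`. -/
def annihilate (v : α) : (Finset α → M) →ₗ[k] (Finset α → M) where
  toFun f := fun τ => if v ∈ τ then 0 else faceSign k τ v • f (insert v τ)
  map_add' f g := by
    funext τ; by_cases h : v ∈ τ <;> simp [h]
  map_smul' c f := by
    funext τ; by_cases h : v ∈ τ <;> simp [h, smul_comm c]

theorem create_apply (v : α) (f : Finset α → M) (τ : Finset α) :
    create (k := k) v f τ = if v ∈ τ then faceSign k τ v • f (τ.erase v) else 0 := rfl

theorem annihilate_apply (v : α) (f : Finset α → M) (τ : Finset α) :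
    annihilate (k := k) v f τ = if v ∈ τ then 0 else faceSign k τ v • f (insert v τ) := rfl

theorem create_create_self (v : α) (f : Finset α → M) :
    create (k := k) v (create (k := k) v f) = 0 := by
  funext τ
  simp [create_apply]

theorem annihilate_annihilate_self (v : α) (f : Finset α → M) :
    annihilate (k := k) v (annihilate (k := k) v f) = 0 := by
  funext τ
  simp [annihilate_apply]

theorem create_create (v w : α) (f : Finset α → M) :
    create (k := k) v (create (k := k) w f) = -create (k := k) w (create (k := k) v f) := by
  obtain rfl | hne := eq_or_ne v w
  · simp [create_create_self]
  funext τ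
  rw [Pi.neg_apply]
  simp only [create_apply, Finset.mem_erase]
  by_cases hv : v ∈ τ <;> by_cases hw : w ∈ τ <;> simp only [hv, hw, hne, hne.symm, ne_eq,
    not_false_eq_true, and_self, and_false, if_true, if_false, smul_zero, neg_zero]
  rw [faceSign_erase k hv, faceSign_erase k hw, Finset.erase_right_comm, smul_smul, smul_smul,
    ← neg_smul]
  congr 1
  rcases lt_or_gt_of_ne hne with h | h <;> simp [h, h.not_gt] <;> ring

theorem annihilate_annihilate (v w : α) (f : Finset α → M) :
    annihilate (k := k) v (annihilate (k := k) w f) =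
      -annihilate (k := k) w (annihilate (k := k) v f) := by
  obtain rfl | hne := eq_or_ne v w
  · simp [annihilate_annihilate_self]
  funext τ
  rw [Pi.neg_apply]
  simp only [annihilate_apply, Finset.mem_insert]
  by_cases hv : v ∈ τ <;> by_cases hw : w ∈ τ <;> simp only [hv, hw, hne, hne.symm, or_false,
    or_true, if_true, if_false, smul_zero, neg_zero]
  rw [faceSign_insert k hv, faceSign_insert k hw, Finset.insert_comm, smul_smul, smul_smul,
    ← neg_smul]
  congr 1
  rcases lt_or_gt_of_ne hne with h | h <;> simp [h, h.not_gt] <;> ring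

theorem create_annihilate_self (v : α) (f : Finset α → M) :
    create (k := k) v (annihilate (k := k) v f) + annihilate (k := k) v (create (k := k) v f) =
      f := by
  funext τ
  simp only [Pi.add_apply, create_apply, annihilate_apply]
  by_cases hv : v ∈ τ
  · simp [hv, faceSign_erase_self, smul_smul, faceSign_mul_self]
  · simp [hv, faceSign_insert_self, smul_smul, faceSign_mul_self]

theorem create_annihilate {v w : α} (hne : v ≠ w) (f : Finset α → M) :
    create (k := k) v (annihilate (k := k) w f) = -annihilate (k := k) w (create (k := k) v f) := by
  funext τ
  rw [Pi.neg_apply]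
  simp only [create_apply, annihilate_apply, Finset.mem_insert, Finset.mem_erase]
  by_cases hv : v ∈ τ <;> by_cases hw : w ∈ τ <;> simp only [hv, hw, hne, hne.symm, or_false,
    or_true, ne_eq, not_false_eq_true, and_true, and_false, if_true, if_false,
    smul_zero, neg_zero]
  rw [faceSign_erase k hv, faceSign_insert k hw, Finset.erase_insert_of_ne hne.symm, smul_smul,
    smul_smul, ← neg_smul]
  congr 1
  rcases lt_or_gt_of_ne hne with h | h <;> simp [h, h.not_gt] <;> ring

/-- An alternating family has vanishing double sum (in any characteristic). -/
theorem sum_sum_eq_zero_of_alternating (s : Finset α) (a : α → α → M) (h0 : ∀ i, a i i = 0)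
    (h : ∀ i j, a i j = -a j i) : ∑ i ∈ s, ∑ j ∈ s, a i j = 0 := by
  induction s using Finset.induction_on with
  | empty => simp
  | insert x s hx ih =>
    simp only [Finset.sum_insert hx, Finset.sum_add_distrib, ih, h0]
    rw [Finset.sum_congr rfl fun i _ => h i x, Finset.sum_neg_distrib]
    simp

theorem sum_create_sum_create (s : Finset α) (f : Finset α → M) :
    (∑ v ∈ s, create (k := k) v) ((∑ v ∈ s, create (k := k) v) f) = 0 := by
  simp only [LinearMap.sum_apply, map_sum]
  exact sum_sum_eq_zero_of_alternating s _ (fun v => create_create_self v f)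
    fun v w => create_create w v f

theorem sum_annihilate_sum_annihilate (s : Finset α) (f : Finset α → M) :
    (∑ v ∈ s, annihilate (k := k) v) ((∑ v ∈ s, annihilate (k := k) v) f) = 0 := by
  simp only [LinearMap.sum_apply, map_sum]
  exact sum_sum_eq_zero_of_alternating s _ (fun v => annihilate_annihilate_self v f)
    fun v w => annihilate_annihilate w v f

/-- Contraction with `w` is a contracting homotopy for the coboundary. -/
theorem sum_create_annihilate {s : Finset α} {w : α} (hw : w ∈ s) (f : Finset α → M) :
    (∑ v ∈ s, create (k := k) v) (annihilate (k := k) w f) +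
      annihilate (k := k) w ((∑ v ∈ s, create (k := k) v) f) = f := by
  simp only [LinearMap.sum_apply, map_sum]
  rw [← Finset.sum_add_distrib, Finset.sum_eq_single w]
  · exact create_annihilate_self w f
  · intro v _ hv
    rw [create_annihilate hv, neg_add_cancel]
  · exact fun h => absurd hw h

/-- Exterior multiplication by `w` is a contracting homotopy for the boundary. -/
theorem sum_annihilate_create {s : Finset α} {w : α} (hw : w ∈ s) (f : Finset α → M) :
    (∑ v ∈ s, annihilate (k := k) v) (create (k := k) w f) +
      create (k := k) w ((∑ v ∈ s, annihilate (k := k) v) f) = f := by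
  simp only [LinearMap.sum_apply, map_sum]
  rw [← Finset.sum_add_distrib, Finset.sum_eq_single w]
  · rw [add_comm]
    exact create_annihilate_self w f
  · intro v _ hv
    rw [create_annihilate hv.symm, add_neg_cancel]
  · exact fun h => absurd hw h

end Operators

/-! ### Comparison of subquotients and of homology -/

section Homology

variable {k V V' : Type*} [Field k] [AddCommGroup V] [Module k V] [AddCommGroup V'] [Module k V']

theorem nonempty_subquotient_equiv (Z B : Submodule k V) (Z' B' : Submodule k V') (f : V →ₗ[k] V')
    (hZ : ∀ z ∈ Z, f z ∈ Z') (hB : ∀ z ∈ Z, z ∈ B → f z ∈ B')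
    (hsurj : ∀ z' ∈ Z', ∃ z ∈ Z, z' - f z ∈ B') (hinj : ∀ z ∈ Z, f z ∈ B' → z ∈ B) :
    Nonempty (Subquotient Z B ≃ₗ[k] Subquotient Z' B') := by
  let g : Z →ₗ[k] Z' := f.restrict hZ
  have hg : B.submoduleOf Z ≤ (B'.submoduleOf Z').comap g := fun z hz => hB z z.2 hz
  refine ⟨LinearEquiv.ofBijective (Submodule.mapQ _ _ g hg) ⟨?_, ?_⟩⟩
  · rw [injective_iff_map_eq_zero]
    intro x hx
    obtain ⟨z, rfl⟩ := Submodule.mkQ_surjective _ x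
    rw [Submodule.mkQ_apply] at hx ⊢
    rw [Submodule.mapQ_apply, Submodule.Quotient.mk_eq_zero] at hx
    rw [Submodule.Quotient.mk_eq_zero]
    exact hinj z z.2 hx
  · intro y
    obtain ⟨z', rfl⟩ := Submodule.mkQ_surjective _ y
    obtain ⟨z, hz, h⟩ := hsurj z' z'.2
    refine ⟨Submodule.Quotient.mk ⟨z, hz⟩, ?_⟩
    rw [Submodule.mapQ_apply, Submodule.mkQ_apply, eq_comm, Submodule.Quotient.eq]
    exact h

/-- A degreewise surjective chain map with acyclic kernel induces isomorphisms in homology. -/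
theorem nonempty_homology_equiv (d : V →ₗ[k] V) (P : ℤ → Submodule k V) (d' : V' →ₗ[k] V')
    (P' : ℤ → Submodule k V') (f : V →ₗ[k] V') (hP : ∀ q, ∀ x ∈ P q, f x ∈ P' q)
    (hd : ∀ q, ∀ x ∈ P q, d x ∈ P (q - 1)) (hdd : ∀ x, d (d x) = 0)
    (hf : ∀ q, ∀ x ∈ P q, f (d x) = d' (f x)) (hsurj : ∀ q, ∀ y ∈ P' q, ∃ x ∈ P q, f x = y)
    (hker : ∀ q, ∀ x ∈ P q, d x = 0 → f x = 0 → ∃ y ∈ P (q + 1), f y = 0 ∧ d y = x) (q : ℤ) :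
    Nonempty (Subquotient (P q ⊓ LinearMap.ker d) ((P (q + 1)).map d) ≃ₗ[k]
      Subquotient (P' q ⊓ LinearMap.ker d') ((P' (q + 1)).map d')) := by
  refine nonempty_subquotient_equiv _ _ _ _ f ?_ ?_ ?_ ?_
  · rintro z ⟨hz, hz0⟩
    refine ⟨hP q z hz, ?_⟩
    change d' (f z) = 0
    rw [← hf q z hz, LinearMap.mem_ker.1 hz0, map_zero]
  · rintro _ _ ⟨y, hy, rfl⟩
    exact ⟨f y, hP _ y hy, (hf _ y hy).symm⟩
  · rintro z ⟨hz, hz0⟩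
    obtain ⟨x, hx, rfl⟩ := hsurj q z hz
    obtain ⟨y, hy, hfy, hdy⟩ := hker (q - 1) (d x) (hd q x hx) (hdd x)
      ((hf q x hx).trans hz0)
    rw [sub_add_cancel] at hy
    refine ⟨x - y, ⟨sub_mem hx hy, ?_⟩, ?_⟩
    · change d (x - y) = 0
      rw [map_sub, hdy, sub_self]
    · rw [map_sub, hfy, sub_zero, sub_self]
      exact zero_mem _
  · rintro z ⟨hz, hz0⟩ ⟨y', hy', hy⟩
    obtain ⟨y, hyP, rfl⟩ := hsurj (q + 1) y' hy'
    have hdy : d y ∈ P q := by simpa using hd _ y hyP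
    obtain ⟨t, ht, -, hdt⟩ := hker q (z - d y) (sub_mem hz hdy)
      (by rw [map_sub, hdd, LinearMap.mem_ker.1 hz0, sub_zero])
      (by rw [map_sub, hf _ y hyP, hy, sub_self])
    exact ⟨y + t, add_mem hyP ht, by rw [map_add, hdt, add_sub_cancel]⟩

/-- A cycle is a boundary if boundaries can be subtracted from it until it lies in the zero step of
a filtration. -/
theorem exists_of_filtration (d : V →ₗ[k] V) (Z Y : Submodule k V) (hY : ∀ y ∈ Y, d y ∈ Z)
    (F : ℕ → V → Prop) (h0 : ∀ x ∈ Z, F 0 x → x = 0)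
    (hs : ∀ n, ∀ x ∈ Z, F (n + 1) x → ∃ y ∈ Y, F n (x - d y)) :
    ∀ n, ∀ x ∈ Z, F n x → ∃ y ∈ Y, d y = x := by
  intro n
  induction n with
  | zero => exact fun x hx hF => ⟨0, zero_mem _, by rw [map_zero, h0 x hx hF]⟩
  | succ n ih =>
    intro x hx hF
    obtain ⟨y, hy, h⟩ := hs n x hx hF
    obtain ⟨t, ht, hdt⟩ := ih _ (sub_mem hx (hY y hy)) h
    exact ⟨y + t, add_mem hy ht, by rw [map_add, hdt, add_sub_cancel]⟩

end Homology

/-! ### Filtered resolutions and their double complex -/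

/-- The faces of `K` inside `σ`. -/
def restriction {m : ℕ} (K : SComplex m) (σ : Finset (Fin m)) : SComplex m where
  carrier := {τ | τ ∈ K ∧ τ ⊆ σ}
  lower' := fun _ _ hba ha => ⟨K.lower hba ha.1, Finset.Subset.trans hba ha.2⟩

/-- The squarefree part of a multigraded free resolution of the face ring of `K`, dehomogenised by
setting all variables to `1`. It is a graded vector space `W` with a differential of degree `-1`,
filtered by subcomplexes indexed by the subsets `τ` of `[m]`. The subcomplex `filt τ` corresponds
to the strand of the resolution in the multidegree of `τ`; it is a resolution of `k` (through
`aug`) if `τ` is a face, and it is exact if `τ` is not a face. -/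
structure FilteredResolution (k : Type*) [Field k] {m : ℕ} (K : SComplex m) (W : Type*)
    [AddCommGroup W] [Module k W] where
  d : W →ₗ[k] W
  d_d : ∀ x, d (d x) = 0
  grade : ℤ → Submodule k W
  d_grade : ∀ q, ∀ x ∈ grade q, d x ∈ grade (q - 1)
  filt : Finset (Fin m) → Submodule k W
  filt_mono : Monotone filt
  d_filt : ∀ τ, ∀ x ∈ filt τ, d x ∈ filt τ
  aug : W →ₗ[k] k
  aug_grade : ∀ q, q ≠ 0 → ∀ x ∈ grade q, aug x = 0
  aug_d : ∀ τ ∈ K, ∀ x ∈ filt τ, aug (d x) = 0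
  exists_aug_eq_one : ∀ τ ∈ K, ∃ x ∈ filt τ ⊓ grade 0, aug x = 1
  exact : ∀ τ q, ∀ x ∈ filt τ ⊓ grade q, d x = 0 → (τ ∈ K → aug x = 0) →
    ∃ y ∈ filt τ ⊓ grade (q + 1), aug y = 0 ∧ d y = x

namespace FilteredResolution

variable {k : Type*} [Field k] {m : ℕ} {K : SComplex m} {W : Type*} [AddCommGroup W] [Module k W]

/-- A model `G` of the quotient of `filt σ` by the sum of the smaller steps `filt (σ \ {v})`,
`v ∈ σ`, with a splitting: `split v` is the projection onto the span of those basis vectors which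
lie in `filt (σ \ {v})` and to which the element `v` is assigned. -/
structure Top (R : FilteredResolution k K W) (σ : Finset (Fin m)) (G : Type*) [AddCommGroup G]
    [Module k G] where
  d : G →ₗ[k] G
  piece : ℤ → Submodule k G
  proj : W →ₗ[k] G
  proj_mem : ∀ q, ∀ x ∈ R.filt σ ⊓ R.grade q, proj x ∈ piece q
  proj_d : ∀ x ∈ R.filt σ, proj (R.d x) = d (proj x)
  proj_surj : ∀ q, ∀ y ∈ piece q, ∃ x ∈ R.filt σ ⊓ R.grade q, proj x = y
  proj_filt : ∀ v ∈ σ, ∀ x ∈ R.filt (σ.erase v), proj x = 0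
  split : Fin m → W →ₗ[k] W
  split_grade : ∀ v q, ∀ x ∈ R.grade q, split v x ∈ R.grade q
  split_filt : ∀ v τ, v ∉ τ → ∀ x ∈ R.filt (insert v τ), split v x ∈ R.filt τ
  sum_split : ∀ x ∈ R.filt σ, proj x = 0 → ∑ v ∈ σ, split v x = x

variable (R : FilteredResolution k K W) (σ : Finset (Fin m))

/-- The differential of the resolution with the sign `(-1)^{|τ|}`, applied to the values of a
function of `τ`. The sign makes it anticommute with the simplicial coboundary. -/
def twistedD : (Finset (Fin m) → W) →ₗ[k] (Finset (Fin m) → W) where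
  toFun f := fun τ => (-1 : k) ^ τ.card • R.d (f τ)
  map_add' f g := by funext τ; simp
  map_smul' c f := by funext τ; simp [smul_comm c]

theorem twistedD_apply (f : Finset (Fin m) → W) (τ : Finset (Fin m)) :
    R.twistedD f τ = (-1 : k) ^ τ.card • R.d (f τ) := rfl

/-- The differential of the total complex of the double complex `⨁_{τ ⊆ σ} filt τ`: the sum of the
simplicial coboundary in `τ` and the differential of the resolution. -/
def totalD : (Finset (Fin m) → W) →ₗ[k] (Finset (Fin m) → W) :=
  ∑ v ∈ σ, create (k := k) v + R.twistedD

/-- The total complex in degree `q`: the functions `τ ↦ f τ ∈ filt τ` that vanish outside the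
subsets of `σ` and whose value at `τ` has degree `q - |σ \ τ|` in the resolution. -/
def totalPiece (q : ℤ) : Submodule k (Finset (Fin m) → W) where
  carrier := {f | ∀ τ, f τ ∈ R.filt τ ⊓ R.grade (q - σ.card + τ.card) ∧ (¬τ ⊆ σ → f τ = 0)}
  add_mem' hf hg := fun τ =>
    ⟨add_mem (hf τ).1 (hg τ).1, fun h => by simp [(hf τ).2 h, (hg τ).2 h]⟩
  zero_mem' := fun τ => ⟨zero_mem _, fun _ => rfl⟩
  smul_mem' c f hf := fun τ =>
    ⟨Submodule.smul_mem _ c (hf τ).1, fun h => by simp [(hf τ).2 h]⟩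

theorem create_twistedD (v : Fin m) (f : Finset (Fin m) → W) :
    create (k := k) v (R.twistedD f) = -R.twistedD (create (k := k) v f) := by
  funext τ
  rw [Pi.neg_apply, create_apply, twistedD_apply, twistedD_apply, create_apply]
  split_ifs with h
  · rw [map_smul, smul_comm, ← neg_smul, ← Finset.card_erase_add_one h, pow_succ]
    simp
  · simp

theorem twistedD_twistedD (f : Finset (Fin m) → W) : R.twistedD (R.twistedD f) = 0 := by
  funext τ
  simp [twistedD_apply, R.d_d]

theorem totalD_totalD (f : Finset (Fin m) → W) : R.totalD σ (R.totalD σ f) = 0 := by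
  have h : (∑ v ∈ σ, create (k := k) v) (R.twistedD f) =
      -R.twistedD ((∑ v ∈ σ, create (k := k) v) f) := by
    simp [LinearMap.sum_apply, create_twistedD]
  simp only [totalD, LinearMap.add_apply, map_add, sum_create_sum_create, twistedD_twistedD, h]
  simp

theorem create_mem_totalPiece {q : ℤ} {f : Finset (Fin m) → W} (hf : f ∈ R.totalPiece σ q)
    {v : Fin m} (hv : v ∈ σ) : create (k := k) v f ∈ R.totalPiece σ (q - 1) := by
  intro τ
  rw [create_apply]
  split_ifs with h
  · have hc : q - 1 - σ.card + τ.card = q - σ.card + (τ.erase v).card := by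
      rw [← Finset.card_erase_add_one h]; push_cast; ring
    rw [hc]
    refine ⟨Submodule.smul_mem _ _ ⟨R.filt_mono (Finset.erase_subset v τ) (hf _).1.1,
      (hf _).1.2⟩, fun hτ => ?_⟩
    rw [(hf _).2, smul_zero]
    intro h'
    apply hτ
    rw [← Finset.insert_erase h]
    exact Finset.insert_subset hv h'
  · exact ⟨zero_mem _, fun _ => rfl⟩

theorem twistedD_mem_totalPiece {q : ℤ} {f : Finset (Fin m) → W} (hf : f ∈ R.totalPiece σ q) :
    R.twistedD f ∈ R.totalPiece σ (q - 1) := by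
  intro τ
  rw [twistedD_apply, show q - 1 - σ.card + τ.card = q - σ.card + τ.card - 1 by ring]
  exact ⟨Submodule.smul_mem _ _ ⟨R.d_filt _ _ (hf τ).1.1, R.d_grade _ _ (hf τ).1.2⟩,
    fun h => by rw [(hf τ).2 h, map_zero, smul_zero]⟩

theorem totalD_mem_totalPiece {q : ℤ} {f : Finset (Fin m) → W} (hf : f ∈ R.totalPiece σ q) :
    R.totalD σ f ∈ R.totalPiece σ (q - 1) := by
  rw [totalD, LinearMap.add_apply, LinearMap.sum_apply]
  exact add_mem (sum_mem fun v hv => R.create_mem_totalPiece σ hf hv)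
    (R.twistedD_mem_totalPiece σ hf)

theorem totalD_apply (f : Finset (Fin m) → W) (τ : Finset (Fin m)) :
    R.totalD σ f τ = ∑ v ∈ σ, create (k := k) v f τ + R.twistedD f τ := by
  simp [totalD, LinearMap.sum_apply, Finset.sum_apply]

/-! ### Projection of the double complex onto the cochains of the restriction -/

/-- The augmentation of the rows `τ ∈ K`, `τ ⊆ σ` of the double complex. -/
def augMap : (Finset (Fin m) → W) →ₗ[k] ({τ : Finset (Fin m) // τ ∈ restriction K σ} → k) where
  toFun f := fun τ => R.aug (f τ)
  map_add' f g := by funext τ; simp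
  map_smul' c f := by funext τ; simp

theorem augMap_apply (f : Finset (Fin m) → W) (τ : {τ : Finset (Fin m) // τ ∈ restriction K σ}) :
    R.augMap σ f τ = R.aug (f τ) := rfl

theorem augMap_totalD {q : ℤ} {f : Finset (Fin m) → W} (hf : f ∈ R.totalPiece σ q) :
    R.augMap σ (R.totalD σ f) = coboundary k (restriction K σ) (R.augMap σ f) := by
  funext τ
  rw [augMap_apply, totalD_apply, map_add, twistedD_apply, map_smul,
    R.aug_d τ.1 τ.2.1 _ (hf τ).1.1, smul_zero, add_zero, map_sum]
  change _ = ∑ w ∈ τ.1, faceSign k τ.1 w * R.aug (f (τ.1.erase w))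
  refine (Finset.sum_subset τ.2.2 ?_).symm.trans (Finset.sum_congr rfl ?_)
  · intro v _ hv
    simp [create_apply, hv]
  · intro v hv
    simp [create_apply, hv]

theorem augMap_mem_cochains {q : ℤ} {f : Finset (Fin m) → W} (hf : f ∈ R.totalPiece σ q) :
    R.augMap σ f ∈ cochains k (restriction K σ) (σ.card - q - 1) := by
  intro τ h
  exact R.aug_grade _ (by lia) _ (hf τ).1.2

theorem exists_augMap_eq {q : ℤ} {c : {τ : Finset (Fin m) // τ ∈ restriction K σ} → k}
    (hc : c ∈ cochains k (restriction K σ) (σ.card - q - 1)) :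
    ∃ f ∈ R.totalPiece σ q, R.augMap σ f = c := by
  classical
  choose! x hx hx1 using R.exists_aug_eq_one
  refine ⟨fun τ => if h : τ ∈ restriction K σ then c ⟨τ, h⟩ • x τ else 0, fun τ => ?_, ?_⟩
  · dsimp only
    split_ifs with h
    · refine ⟨?_, fun h' => absurd h.2 h'⟩
      by_cases h0 : q - σ.card + τ.card = 0
      · rw [h0]
        exact Submodule.smul_mem _ _ (hx τ h.1)
      · rw [hc ⟨τ, h⟩ (by dsimp only; lia), zero_smul]
        exact zero_mem _
    · exact ⟨zero_mem _, fun _ => rfl⟩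
  · funext τ
    rw [augMap_apply]
    simp [τ.2, hx1 τ.1 τ.2.1]

/-- The kernel of the augmentation is acyclic: a cycle is corrected on ever larger sets `τ`, with
the exactness of the resolution in each `filt τ`. -/
theorem exists_totalD_eq_of_augMap_eq_zero {q : ℤ} {f : Finset (Fin m) → W}
    (hf : f ∈ R.totalPiece σ q) (hd : R.totalD σ f = 0) (h0 : R.augMap σ f = 0) :
    ∃ g ∈ R.totalPiece σ (q + 1), R.augMap σ g = 0 ∧ R.totalD σ g = f := by
  have key := exists_of_filtration (R.totalD σ)
    (R.totalPiece σ q ⊓ LinearMap.ker (R.totalD σ) ⊓ LinearMap.ker (R.augMap σ))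
    (R.totalPiece σ (q + 1) ⊓ LinearMap.ker (R.augMap σ))
    (by
      rintro g ⟨hg, hg0⟩
      refine ⟨⟨by simpa using R.totalD_mem_totalPiece σ hg, R.totalD_totalD σ g⟩, ?_⟩
      change R.augMap σ (R.totalD σ g) = 0
      rw [R.augMap_totalD σ hg, LinearMap.mem_ker.1 hg0, map_zero])
    (fun n x => ∀ τ : Finset (Fin m), τ.card + n < m + 1 → x τ = 0)
    (by
      intro x _ h
      funext τ
      exact h τ (by simpa [Nat.lt_succ_iff] using τ.card_le_univ))
    (by
      classical
      rintro n x ⟨⟨hx, hxd⟩, hx0⟩ hn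
      -- On the smallest sets where `x` does not vanish, its values are cycles.
      have hcyc : ∀ τ : Finset (Fin m), τ.card + n < m + 1 → R.d (x τ) = 0 := by
        intro τ hτ
        have h := congrFun hxd τ
        rw [totalD_apply, Finset.sum_eq_zero, zero_add, twistedD_apply, Pi.zero_apply,
          smul_eq_zero_iff_right (pow_ne_zero _ (neg_ne_zero.2 one_ne_zero))] at h
        · exact h
        · intro v _
          rw [create_apply]
          split_ifs with hv
          · rw [hn _ (by rw [Finset.card_erase_of_mem hv]; have := Finset.card_pos.2 ⟨v, hv⟩; lia),
              smul_zero]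
          · rfl
      have hex : ∀ τ : Finset (Fin m), ∃ y ∈ R.filt τ ⊓ R.grade (q + 1 - σ.card + τ.card),
          (¬τ ⊆ σ → y = 0) ∧ R.aug y = 0 ∧ (τ.card + n < m → y = 0) ∧
            (τ.card + n < m + 1 → (-1 : k) ^ τ.card • R.d y = x τ) := by
        intro τ
        by_cases hσ : τ ⊆ σ
        · by_cases hτ : τ.card + n = m
          · obtain ⟨y, hy, hy0, hdy⟩ := R.exact τ _ (x τ) (hx τ).1 (hcyc τ (by lia))
              (fun h => congrFun hx0 ⟨τ, h, hσ⟩)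
            refine ⟨(-1 : k) ^ τ.card • y, Submodule.smul_mem _ _ ?_,
              fun h => absurd hσ h, ?_, fun h => by lia, fun _ => ?_⟩
            · rwa [show q + 1 - σ.card + τ.card = q - σ.card + τ.card + 1 by ring]
            · rw [map_smul, hy0, smul_zero]
            · rw [map_smul, hdy, smul_smul, ← mul_pow]
              simp
          · exact ⟨0, zero_mem _, fun _ => rfl, map_zero _, fun _ => rfl, fun h => by
              rw [map_zero, smul_zero, hn τ (by lia)]⟩
        · exact ⟨0, zero_mem _, fun _ => rfl, map_zero _, fun _ => rfl, fun _ => by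
            rw [map_zero, smul_zero, (hx τ).2 hσ]⟩
      choose g hg hgσ hg0 hgn hdg using hex
      refine ⟨g, ⟨fun τ => ⟨hg τ, hgσ τ⟩, funext fun τ => hg0 τ⟩, fun τ hτ => ?_⟩
      rw [Pi.sub_apply, totalD_apply, Finset.sum_eq_zero, zero_add, twistedD_apply, hdg τ hτ,
        sub_self]
      intro v _
      rw [create_apply]
      split_ifs with hv
      · rw [hgn _ (by rw [Finset.card_erase_of_mem hv]; have := Finset.card_pos.2 ⟨v, hv⟩; lia),
          smul_zero]
      · rfl)
  obtain ⟨g, ⟨hg, hg0⟩, h⟩ := key (m + 1) f ⟨⟨hf, hd⟩, h0⟩ (fun τ h => by lia)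
  exact ⟨g, hg, hg0, h⟩

/-! ### Projection of the double complex onto the top quotient -/

namespace Top

variable {R σ} {G : Type*} [AddCommGroup G] [Module k G] (T : R.Top σ G)

/-- The projection of the row `τ = σ` of the double complex. -/
def projMap : (Finset (Fin m) → W) →ₗ[k] G := T.proj ∘ₗ LinearMap.proj σ

theorem projMap_apply (f : Finset (Fin m) → W) : T.projMap f = T.proj (f σ) := rfl

theorem proj_create {q : ℤ} {f : Finset (Fin m) → W} (hf : f ∈ R.totalPiece σ q) {v : Fin m}
    (hv : v ∈ σ) : T.proj (create (k := k) v f σ) = 0 := by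
  rw [create_apply, if_pos hv, map_smul, T.proj_filt v hv _ (hf _).1.1, smul_zero]

theorem projMap_totalD {q : ℤ} {f : Finset (Fin m) → W} (hf : f ∈ R.totalPiece σ q) :
    T.projMap (R.totalD σ f) = (-1 : k) ^ σ.card • T.d (T.projMap f) := by
  rw [projMap_apply, totalD_apply, map_add, map_sum, Finset.sum_eq_zero fun v hv =>
    T.proj_create hf hv, zero_add, twistedD_apply, map_smul, T.proj_d _ (hf σ).1.1, projMap_apply]

theorem exists_projMap_eq {q : ℤ} {y : G} (hy : y ∈ T.piece q) :
    ∃ f ∈ R.totalPiece σ q, T.projMap f = y := by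
  classical
  obtain ⟨x, hx, rfl⟩ := T.proj_surj q y hy
  refine ⟨Pi.single σ x, fun τ => ?_, by rw [projMap_apply, Pi.single_eq_same]⟩
  obtain rfl | h := eq_or_ne τ σ
  · rw [Pi.single_eq_same, sub_add_cancel]
    exact ⟨hx, fun h => absurd (Finset.Subset.refl _) h⟩
  · rw [Pi.single_eq_of_ne h]
    exact ⟨zero_mem _, fun _ => rfl⟩

/-- The Koszul contraction: contract each basis vector with the element of `σ` assigned to it. -/
def contraction : (Finset (Fin m) → W) →ₗ[k] (Finset (Fin m) → W) :=
  ∑ v ∈ σ, (T.split v).compLeft (Finset (Fin m)) ∘ₗ annihilate v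

theorem contraction_apply (f : Finset (Fin m) → W) (τ : Finset (Fin m)) :
    T.contraction f τ = ∑ v ∈ σ, T.split v (annihilate (k := k) v f τ) := by
  simp [contraction, LinearMap.sum_apply, Finset.sum_apply]

theorem create_split (v w : Fin m) (f : Finset (Fin m) → W) :
    create (k := k) w ((T.split v).compLeft _ f) =
      (T.split v).compLeft _ (create (k := k) w f) := by
  funext τ
  simp only [create_apply, LinearMap.compLeft_apply, Function.comp_apply]
  split_ifs <;> simp

theorem contraction_mem {q : ℤ} {f : Finset (Fin m) → W} (hf : f ∈ R.totalPiece σ q) :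
    T.contraction f ∈ R.totalPiece σ (q + 1) := by
  intro τ
  rw [contraction_apply]
  have key : ∀ v ∈ σ, T.split v (annihilate (k := k) v f τ) ∈
      R.filt τ ⊓ R.grade (q + 1 - σ.card + τ.card) ∧
        (¬τ ⊆ σ → T.split v (annihilate (k := k) v f τ) = 0) := by
    intro v _
    rw [annihilate_apply]
    split_ifs with h
    · rw [map_zero]
      exact ⟨zero_mem _, fun _ => rfl⟩
    · have hc : q + 1 - σ.card + τ.card = q - σ.card + (insert v τ).card := by
        rw [Finset.card_insert_of_notMem h]; push_cast; ring
      rw [map_smul, hc]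
      refine ⟨Submodule.smul_mem _ _ ⟨T.split_filt v τ h _ (hf _).1.1,
        T.split_grade v _ _ (hf _).1.2⟩, fun hτ => ?_⟩
      rw [(hf _).2 fun h' => hτ ((Finset.subset_insert v τ).trans h'), map_zero, smul_zero]
  exact ⟨sum_mem fun v hv => (key v hv).1, fun h => Finset.sum_eq_zero fun v hv => (key v hv).2 h⟩

theorem contraction_self (f : Finset (Fin m) → W) : T.contraction f σ = 0 := by
  rw [contraction_apply]
  refine Finset.sum_eq_zero fun v hv => ?_
  rw [annihilate_apply, if_pos hv, map_zero]

theorem proj_eq_zero_of_ssubset {τ : Finset (Fin m)} (h : τ ⊂ σ) {x : W} (hx : x ∈ R.filt τ) :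
    T.proj x = 0 := by
  obtain ⟨v, hv, hvτ⟩ := Finset.exists_of_ssubset h
  exact T.proj_filt v hv x (R.filt_mono (Finset.subset_erase.2 ⟨h.1, hvτ⟩) hx)

theorem sum_split_apply {q : ℤ} {f : Finset (Fin m) → W} (hf : f ∈ R.totalPiece σ q)
    (h0 : T.projMap f = 0) (τ : Finset (Fin m)) : ∑ v ∈ σ, T.split v (f τ) = f τ := by
  by_cases hτ : τ ⊆ σ
  · refine T.sum_split _ (R.filt_mono hτ (hf τ).1.1) ?_
    obtain rfl | hne := eq_or_ne τ σ
    · exact h0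
    · exact T.proj_eq_zero_of_ssubset (hτ.ssubset_of_ne hne) (hf τ).1.1
  · simp [(hf τ).2 hτ]

/-- The contraction is a contracting homotopy for the simplicial part of the differential. -/
theorem sum_create_contraction {q : ℤ} {f : Finset (Fin m) → W} (hf : f ∈ R.totalPiece σ q)
    (h0 : T.projMap f = 0) :
    (∑ v ∈ σ, create (k := k) v) (T.contraction f) +
      T.contraction ((∑ v ∈ σ, create (k := k) v) f) = f := by
  have h1 : (∑ v ∈ σ, create (k := k) v) (T.contraction f) =
      ∑ v ∈ σ, (T.split v).compLeft _ ((∑ w ∈ σ, create (k := k) w) (annihilate (k := k) v f)) := by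
    simp only [contraction, LinearMap.sum_apply, LinearMap.comp_apply, map_sum, create_split]
  have h2 : T.contraction ((∑ v ∈ σ, create (k := k) v) f) =
      ∑ v ∈ σ, (T.split v).compLeft _ (annihilate (k := k) v ((∑ w ∈ σ, create (k := k) w) f)) := by
    rw [contraction, LinearMap.sum_apply]
    rfl
  rw [h1, h2, ← Finset.sum_add_distrib]
  funext τ
  rw [Finset.sum_apply, ← T.sum_split_apply hf h0 τ]
  refine Finset.sum_congr rfl fun v hv => ?_
  rw [← map_add, sum_create_annihilate hv]
  rfl

/-- The kernel of the projection is acyclic: a cycle is corrected on ever smaller sets `τ`, with the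
Koszul contraction. -/
theorem exists_totalD_eq_of_projMap_eq_zero {q : ℤ} {f : Finset (Fin m) → W}
    (hf : f ∈ R.totalPiece σ q) (hd : R.totalD σ f = 0) (h0 : T.projMap f = 0) :
    ∃ g ∈ R.totalPiece σ (q + 1), T.projMap g = 0 ∧ R.totalD σ g = f := by
  have key := exists_of_filtration (R.totalD σ)
    (R.totalPiece σ q ⊓ LinearMap.ker (R.totalD σ) ⊓ LinearMap.ker T.projMap)
    (R.totalPiece σ (q + 1) ⊓ LinearMap.ker T.projMap)
    (by
      rintro g ⟨hg, hg0⟩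
      refine ⟨⟨by simpa using R.totalD_mem_totalPiece σ hg, R.totalD_totalD σ g⟩, ?_⟩
      change T.projMap (R.totalD σ g) = 0
      rw [T.projMap_totalD hg, LinearMap.mem_ker.1 hg0, map_zero, smul_zero])
    (fun n x => ∀ τ : Finset (Fin m), n ≤ τ.card → x τ = 0)
    (fun x _ h => funext fun τ => h τ (Nat.zero_le _))
    (by
      rintro n x ⟨⟨hx, hxd⟩, hx0⟩ hn
      refine ⟨T.contraction x, ⟨T.contraction_mem hx, ?_⟩, fun τ hτ => ?_⟩
      · change T.proj (T.contraction x σ) = 0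
        rw [contraction_self, map_zero]
      have h1 := T.sum_create_contraction hx hx0
      have h2 : (∑ v ∈ σ, create (k := k) v) x = -R.twistedD x := by
        rw [eq_neg_iff_add_eq_zero]
        exact hxd
      -- The error term `x - D h x` involves `x` only on sets with one more element than `τ`.
      have hvan : ∀ y : Finset (Fin m) → W, (∀ τ : Finset (Fin m), n + 1 ≤ τ.card → y τ = 0) →
          T.contraction y τ = 0 := by
        intro y hy
        rw [contraction_apply]
        refine Finset.sum_eq_zero fun v _ => ?_
        rw [annihilate_apply]
        split_ifs with hv
        · rw [map_zero]
        · rw [hy _ (by rw [Finset.card_insert_of_notMem hv]; lia), smul_zero, map_zero]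
      rw [h2] at h1
      have h3 : x - R.totalD σ (T.contraction x) =
          T.contraction (-R.twistedD x) - R.twistedD (T.contraction x) := by
        nth_rewrite 1 [← h1]
        rw [totalD, LinearMap.add_apply]
        abel
      rw [h3, Pi.sub_apply, twistedD_apply, hvan x hn, hvan, map_zero, smul_zero, sub_zero]
      intro τ' hτ'
      rw [Pi.neg_apply, twistedD_apply, hn τ' hτ', map_zero, smul_zero, neg_zero])
  obtain ⟨g, ⟨hg, hg0⟩, h⟩ := key (m + 1) f ⟨⟨hf, hd⟩, h0⟩ (fun τ h => by
    have := τ.card_le_univ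
    rw [Fintype.card_fin] at this
    lia)
  exact ⟨g, hg, hg0, h⟩

/-- Hochster's formula: the homology of the top quotient is the reduced cohomology of the
restriction of the complex to `σ`, because both are quotients of the total complex by acyclic
subcomplexes. -/
theorem nonempty_homology_equiv_reducedCohomology (q : ℤ) :
    Nonempty (Subquotient (T.piece q ⊓ LinearMap.ker T.d) ((T.piece (q + 1)).map T.d) ≃ₗ[k]
      ReducedCohomology k (restriction K σ) (σ.card - q - 1)) := by
  have hu : ((-1 : k) ^ σ.card) ≠ 0 := pow_ne_zero _ (neg_ne_zero.2 one_ne_zero)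
  obtain ⟨e1⟩ := nonempty_homology_equiv (R.totalD σ) (R.totalPiece σ)
    ((-1 : k) ^ σ.card • T.d) T.piece T.projMap (fun q f hf => T.proj_mem q _ (by
      have h := (hf σ).1
      rwa [sub_add_cancel] at h)) (fun q f => R.totalD_mem_totalPiece σ) (R.totalD_totalD σ)
    (fun q f => T.projMap_totalD) (fun q y => T.exists_projMap_eq)
    (fun q f => T.exists_totalD_eq_of_projMap_eq_zero) q
  obtain ⟨e2⟩ := nonempty_homology_equiv (R.totalD σ) (R.totalPiece σ)
    (coboundary k (restriction K σ)) (fun q => cochains k (restriction K σ) (σ.card - q - 1))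
    (R.augMap σ) (fun q f => R.augMap_mem_cochains σ) (fun q f => R.totalD_mem_totalPiece σ)
    (R.totalD_totalD σ) (fun q f => R.augMap_totalD σ) (fun q c => R.exists_augMap_eq σ)
    (fun q f => R.exists_totalD_eq_of_augMap_eq_zero σ) q
  rw [LinearMap.ker_smul _ _ hu, Submodule.map_smul _ _ _ hu] at e1
  rw [show (σ.card : ℤ) - (q + 1) - 1 = σ.card - q - 1 - 1 by ring] at e2
  exact ⟨e1.symm.trans e2⟩

end Top
end FilteredResolution

/-! ### Stanley-Reisner ideals and simplicial complements -/

section Ideals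

variable {k : Type u} [Field k] {m n : ℕ}

theorem expVec_apply (σ : Finset (Fin m)) (v : Fin m) : expVec σ v = if v ∈ σ then 1 else 0 := by
  classical
  simp [expVec, Finsupp.finsetSum_apply, Finsupp.single_apply]

theorem expVec_le_iff (σ : Finset (Fin m)) (a : Fin m →₀ ℕ) : expVec σ ≤ a ↔ σ ⊆ a.support := by
  rw [Finsupp.le_def]
  refine ⟨fun h v hv => ?_, fun h v => ?_⟩
  · have := h v
    rw [expVec_apply, if_pos hv] at this
    rw [Finsupp.mem_support_iff]
    lia
  · rw [expVec_apply]
    split_ifs with hv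
    · exact Nat.one_le_iff_ne_zero.2 (Finsupp.mem_support_iff.1 (h hv))
    · exact Nat.zero_le _

theorem support_expVec (σ : Finset (Fin m)) : (expVec σ).support = σ := by
  ext v
  simp [expVec_apply]

theorem expVec_le_expVec {σ τ : Finset (Fin m)} : expVec σ ≤ expVec τ ↔ σ ⊆ τ := by
  rw [expVec_le_iff, support_expVec]

theorem mem_stanleyReisnerIdeal {K : SComplex m} {p : MvPolynomial (Fin m) k} :
    p ∈ stanleyReisnerIdeal k K ↔ ∀ a ∈ p.support, a.support ∉ K := by
  rw [stanleyReisnerIdeal, ← Set.image_image (fun a => MvPolynomial.monomial a (1 : k)) expVec,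
    MvPolynomial.mem_ideal_span_monomial_image]
  refine forall₂_congr fun a _ => ⟨?_, fun h => ⟨_, ⟨a.support, h, rfl⟩, ?_⟩⟩
  · rintro ⟨_, ⟨τ, hτ, rfl⟩, h⟩ ha
    exact hτ (K.lower ((expVec_le_iff _ _).1 h) ha)
  · rw [expVec_le_iff]

theorem mem_monomialIdeal {P : Fin n → Finset (Fin m)} {p : MvPolynomial (Fin m) k} :
    p ∈ monomialIdeal k P ↔ ∀ a ∈ p.support, ∃ j, P j ⊆ a.support := by
  rw [monomialIdeal, show (Set.range fun j => MvPolynomial.monomial (expVec (P j)) (1 : k)) =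
    (fun a => MvPolynomial.monomial a (1 : k)) '' Set.range (fun j => expVec (P j)) by
      rw [← Set.range_comp]; rfl, MvPolynomial.mem_ideal_span_monomial_image]
  simp [expVec_le_iff]

theorem monomial_mem_stanleyReisnerIdeal {K : SComplex m} {a : Fin m →₀ ℕ} :
    MvPolynomial.monomial a (1 : k) ∈ stanleyReisnerIdeal k K ↔ a.support ∉ K := by
  rw [mem_stanleyReisnerIdeal]
  simp

/-- A sequence is a simplicial complement if and only if the non-faces are the sets that contain one
of its members. -/
theorem isSimplicialComplement_iff {P : Fin n → Finset (Fin m)} {K : SComplex m} :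
    IsSimplicialComplement k P K ↔ ∀ τ, τ ∉ K ↔ ∃ j, P j ⊆ τ := by
  refine ⟨fun h τ => ?_, fun h => ?_⟩
  · have h1 := mem_monomialIdeal (k := k) (P := P) (p := MvPolynomial.monomial (expVec τ) 1)
    rw [h, monomial_mem_stanleyReisnerIdeal] at h1
    simpa [support_expVec] using h1
  · ext p
    rw [mem_monomialIdeal, mem_stanleyReisnerIdeal]
    simp only [h]

theorem isSimplicialComplement_compression {P : Fin n → Finset (Fin m)} {K : SComplex m}
    (hP : IsSimplicialComplement k P K) (ω : Finset (Fin m)) :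
    IsSimplicialComplement k (compression ω P) (star K ω) := by
  rw [isSimplicialComplement_iff] at hP ⊢
  intro τ
  have h1 : τ ∈ star K ω ↔ ω ∪ τ ∈ K :=
    ⟨fun h => h.2, fun h => ⟨K.lower Finset.subset_union_right h, h⟩⟩
  rw [h1, hP]
  exact exists_congr fun j => (sdiff_le_iff (a := P j) (b := ω) (c := τ)).symm

theorem compression_nonempty {P : Fin n → Finset (Fin m)} {K : SComplex m}
    (hP : IsSimplicialComplement k P K) {ω : Finset (Fin m)} (hω : ω ∈ K) (j : Fin n) :
    (compression ω P j).Nonempty := by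
  rw [isSimplicialComplement_iff] at hP
  rw [compression, Finset.sdiff_nonempty]
  exact fun h => (hP ω).2 ⟨j, h⟩ hω

end Ideals

theorem sum_ite_isLeast {α M : Type*} [LinearOrder α] [AddCommMonoid M] {σ A : Finset α}
    (hA : A ⊆ σ) (hne : A.Nonempty) (c : M) [∀ v, Decidable (IsLeast (A : Set α) v)] :
    ∑ v ∈ σ, (if IsLeast (A : Set α) v then c else 0) = c := by
  have hmin := A.isLeast_min' hne
  rw [Finset.sum_eq_single (A.min' hne), if_pos hmin]
  · exact fun v _ hv => if_neg fun h => hv (h.unique hmin)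
  · exact fun h => absurd (hA hmin.1) h

/-! ### The Taylor complex of a simplicial complement -/

section Taylor

variable {k : Type u} [Field k] {m n : ℕ}

theorem unionOf_mono (P : Fin n → Finset (Fin m)) : Monotone (unionOf P) :=
  fun _ _ h => Finset.biUnion_subset_biUnion_of_subset_left _ h

theorem subset_unionOf (P : Fin n → Finset (Fin m)) {S : Finset (Fin n)} {j : Fin n} (hj : j ∈ S) :
    P j ⊆ unionOf P S := Finset.subset_biUnion_of_mem _ hj

theorem unionOf_insert (P : Fin n → Finset (Fin m)) (j : Fin n) (S : Finset (Fin n)) :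
    unionOf P (insert j S) = P j ∪ unionOf P S := Finset.biUnion_insert

/-- The simplicial boundary of the full simplex on `n` vertices, on coefficient functions. -/
def simplexBoundary (k : Type u) [Field k] (n : ℕ) :
    (Finset (Fin n) → k) →ₗ[k] (Finset (Fin n) → k) :=
  -∑ j, annihilate (k := k) j

theorem simplexBoundary_apply (x : Finset (Fin n) → k) (T : Finset (Fin n)) :
    simplexBoundary k n x T =
      -∑ j, if j ∈ T then 0 else faceSign k T j * x (insert j T) := by
  simp [simplexBoundary, LinearMap.sum_apply, Finset.sum_apply, annihilate_apply]

theorem exists_of_simplexBoundary_ne_zero {x : Finset (Fin n) → k} {T : Finset (Fin n)}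
    (h : simplexBoundary k n x T ≠ 0) : ∃ j, j ∉ T ∧ x (insert j T) ≠ 0 := by
  rw [simplexBoundary_apply, neg_ne_zero] at h
  obtain ⟨j, -, hj⟩ := Finset.exists_ne_zero_of_sum_ne_zero h
  split_ifs at hj with hjT
  · exact absurd rfl hj
  · exact ⟨j, hjT, right_ne_zero_of_mul hj⟩

/-- Functions supported on a given set. -/
def supportedFunctions (k : Type u) [Field k] {ι : Type*} (s : Set ι) : Submodule k (ι → k) where
  carrier := {x | ∀ i, x i ≠ 0 → i ∈ s}
  add_mem' {x y} hx hy := fun i h => by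
    by_cases h1 : x i = 0
    · exact hy i fun h2 => h (by simp [h1, h2])
    · exact hx i h1
  zero_mem' := fun i h => absurd rfl h
  smul_mem' c x hx := fun i h => hx i fun h1 => h (by simp [h1])

/-- The exterior algebra on `σ_1, …, σ_n` with the boundary of the full simplex: the Taylor
resolution, dehomogenised. The step `τ` of the filtration is spanned by the symbols with union in
`τ`. -/
def taylorResolution {P : Fin n → Finset (Fin m)} {K : SComplex m}
    (hP : ∀ τ, τ ∉ K ↔ ∃ j, P j ⊆ τ) : FilteredResolution k K (Finset (Fin n) → k) where
  d := simplexBoundary k n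
  d_d x := by
    rw [simplexBoundary, LinearMap.neg_apply, LinearMap.neg_apply, map_neg, neg_neg,
      sum_annihilate_sum_annihilate]
  grade q := supportedFunctions k {S | (S.card : ℤ) = q}
  d_grade q x hx T hT := by
    obtain ⟨j, hj, h⟩ := exists_of_simplexBoundary_ne_zero hT
    have := hx _ h
    rw [Set.mem_ofPred_eq, Finset.card_insert_of_notMem hj] at this
    rw [Set.mem_ofPred_eq]
    lia
  filt τ := supportedFunctions k {S | unionOf P S ⊆ τ}
  filt_mono τ τ' h x hx S hS := (hx S hS).trans h
  d_filt τ x hx T hT := by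
    obtain ⟨j, hj, h⟩ := exists_of_simplexBoundary_ne_zero hT
    exact (unionOf_mono P (Finset.subset_insert j T)).trans (hx _ h)
  aug := LinearMap.proj (R := k) (φ := fun _ : Finset (Fin n) => k) ∅
  aug_grade q hq x hx := by
    by_contra h
    have := hx _ h
    exact hq (by simpa using this.symm)
  aug_d τ hτ x hx := by
    by_contra h
    obtain ⟨j, hj, h⟩ := exists_of_simplexBoundary_ne_zero h
    exact (hP τ).2 ⟨j, (subset_unionOf P (Finset.mem_insert_self j ∅)).trans (hx _ h)⟩ hτ
  exists_aug_eq_one τ _ := by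
    classical
    refine ⟨Pi.single ∅ 1, ⟨fun S hS => ?_, fun S hS => ?_⟩, by simp⟩ <;>
    · obtain rfl : S = ∅ := by
        by_contra h
        exact hS (Pi.single_eq_of_ne h _)
      simp [unionOf]
  exact τ q x hx hd h0 := by
    by_cases hτ : τ ∈ K
    · refine ⟨0, zero_mem _, map_zero _, ?_⟩
      rw [map_zero, eq_comm]
      funext S
      by_contra h
      obtain rfl | ⟨j, hj⟩ := S.eq_empty_or_nonempty
      · exact h (h0 hτ)
      · exact (hP τ).2 ⟨j, (subset_unionOf P hj).trans (hx.1 S h)⟩ hτ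
    · obtain ⟨j, hj⟩ := (hP τ).1 hτ
      refine ⟨-create (k := k) j x, ⟨fun S hS => ?_, fun S hS => ?_⟩, ?_, ?_⟩
      · rw [Pi.neg_apply, neg_ne_zero, create_apply] at hS
        split_ifs at hS with hjS
        · have := hx.1 _ (right_ne_zero_of_mul hS)
          rw [Set.mem_ofPred_eq, ← Finset.insert_erase hjS, unionOf_insert]
          exact Finset.union_subset hj this
        · exact absurd rfl hS
      · rw [Pi.neg_apply, neg_ne_zero, create_apply] at hS
        split_ifs at hS with hjS
        · have := hx.2 _ (right_ne_zero_of_mul hS)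
          rw [Set.mem_ofPred_eq] at this ⊢
          rw [← this, ← Finset.card_erase_add_one hjS]
          push_cast
          rfl
        · exact absurd rfl hS
      · simp [create_apply]
      · have h1 := sum_annihilate_create (k := k) (Finset.mem_univ j) x
        have h2 : (∑ v, annihilate (k := k) v) x = 0 := by
          rw [← neg_eq_zero]; exact hd
        rw [h2, map_zero, add_zero] at h1
        rw [simplexBoundary, LinearMap.neg_apply, map_neg, neg_neg, h1]

theorem lambdaD_apply (P : Fin n → Finset (Fin m)) (y : Finset (Fin n) →₀ k)
    (T : Finset (Fin n)) :
    lambdaD k P y T = -∑ j, if j ∉ T ∧ unionOf P (insert j T) = unionOf P T then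
      faceSign k T j * y (insert j T) else 0 := by
  induction y using Finsupp.induction_linear with
  | zero => simp
  | add f g hf hg =>
    rw [map_add, Finsupp.add_apply, hf, hg, ← neg_add, ← Finset.sum_add_distrib]
    refine congrArg _ (Finset.sum_congr rfl fun j _ => ?_)
    split_ifs
    · rw [Finsupp.add_apply, mul_add]
    · rw [add_zero]
  | single S c =>
    have h1 : ∀ g : Fin n → k, ∑ i ∈ S, g i = ∑ i, if i ∈ S then g i else 0 := fun g => by
      rw [Finset.sum_ite_mem, Finset.univ_inter]
    rw [lambdaD, Finsupp.linearCombination_single, Finsupp.smul_apply, Finsupp.finsetSum_apply,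
      smul_eq_mul, Finset.sum_filter, h1, Finset.mul_sum, ← Finset.sum_neg_distrib]
    refine Finset.sum_congr rfl fun i _ => ?_
    by_cases hi : i ∈ S ∧ S.erase i = T
    · obtain ⟨hi, rfl⟩ := hi
      have h2 : (S.filter (· ≤ i)).card = ((S.erase i).filter (· < i)).card + 1 := by
        rw [← Finset.card_erase_add_one (a := i) (s := S.filter (· ≤ i)) (by simp [hi])]
        congr 2
        ext j
        simp only [Finset.mem_erase, Finset.mem_filter, lt_iff_le_and_ne]
        tauto
      simp only [hi, if_true, Finset.notMem_erase, not_false_eq_true, true_and,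
        Finset.insert_erase hi, Finsupp.single_eq_same, h2, faceSign, pow_succ, eq_comm]
      split_ifs <;> ring
    · rw [Finsupp.single_apply, Finsupp.single_apply]
      have h3 : ¬(i ∉ T ∧ S = insert i T) := by
        rintro ⟨h, rfl⟩
        exact hi ⟨Finset.mem_insert_self i T, Finset.erase_insert h⟩
      by_cases hS : i ∈ S
      · have h4 : S.erase i ≠ T := fun h => hi ⟨hS, h⟩
        by_cases hT : i ∈ T
        · simp [h4, hT]
        · have h5 : S ≠ insert i T := fun h => h3 ⟨hT, h⟩
          simp [h4, h5]
      · by_cases hT : i ∈ T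
        · simp [hS, hT]
        · have h5 : S ≠ insert i T := fun h => h3 ⟨hT, h⟩
          simp [hS, h5]

/-- Restriction of a function to a set, extended by zero. -/
def mask (k : Type u) [Field k] {ι : Type*} (s : Set ι) [DecidablePred (· ∈ s)] :
    (ι → k) →ₗ[k] (ι → k) where
  toFun x := fun i => if i ∈ s then x i else 0
  map_add' x y := by funext i; by_cases h : i ∈ s <;> simp [h]
  map_smul' c x := by funext i; by_cases h : i ∈ s <;> simp [h]

theorem mask_apply {ι : Type*} (s : Set ι) [DecidablePred (· ∈ s)] (x : ι → k) (i : ι) :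
    mask k s x i = if i ∈ s then x i else 0 := rfl

theorem mask_mem {ι : Type*} (s t : Set ι) [DecidablePred (· ∈ s)] {x : ι → k}
    (hx : x ∈ supportedFunctions k t) : mask k s x ∈ supportedFunctions k (s ∩ t) := by
  intro i hi
  rw [mask_apply] at hi
  split_ifs at hi with h
  · exact ⟨h, hx i hi⟩
  · exact absurd rfl hi

open Classical in
/-- The complex `Λ̄^{*,σ}(P)` is the top quotient of the Taylor complex at `σ`. -/
def taylorTop {P : Fin n → Finset (Fin m)} {K : SComplex m}
    (hP : ∀ τ, τ ∉ K ↔ ∃ j, P j ⊆ τ) (σ : Finset (Fin m)) :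
    (taylorResolution (k := k) hP).Top σ (Finset (Fin n) →₀ k) where
  d := lambdaD k P
  piece q := Finsupp.supported k k {S | (S.card : ℤ) = q ∧ unionOf P S = σ}
  proj := (Finsupp.linearEquivFunOnFinite k k (Finset (Fin n))).symm.toLinearMap ∘ₗ
    mask k {S | unionOf P S = σ}
  proj_mem q x hx := by
    rw [Finsupp.mem_supported']
    intro S hS
    change mask k {S | unionOf P S = σ} x S = 0
    by_contra h
    exact hS (mask_mem _ _ hx.2 S h).symm
  proj_d x hx := by
    ext T
    rw [lambdaD_apply]
    change mask k {S | unionOf P S = σ} (simplexBoundary k n x) T =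
      -∑ j, if j ∉ T ∧ unionOf P (insert j T) = unionOf P T then
        faceSign k T j * mask k {S | unionOf P S = σ} x (insert j T) else 0
    simp only [mask_apply, Set.mem_ofPred_eq]
    split_ifs with hT
    · rw [simplexBoundary_apply]
      refine congrArg _ (Finset.sum_congr rfl fun j _ => ?_)
      by_cases hj : j ∈ T
      · simp [hj]
      by_cases hu : unionOf P (insert j T) = σ
      · simp [hj, hu, hT]
      · have h0 : x (insert j T) = 0 := by
          by_contra h
          refine hu (le_antisymm (hx _ h) ?_)
          rw [← hT]
          exact unionOf_mono P (Finset.subset_insert j T)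
        simp [h0]
    · rw [Finset.sum_eq_zero, neg_zero]
      intro j _
      split_ifs with h1 h2
      · exact absurd (h1.2.symm.trans h2) hT
      · rw [mul_zero]
      · rfl
  proj_surj q y hy := by
    rw [Finsupp.mem_supported'] at hy
    have hy' : ∀ S, y S ≠ 0 → (S.card : ℤ) = q ∧ unionOf P S = σ := fun S hS => by
      by_contra h
      exact hS (hy S h)
    refine ⟨y, ⟨fun S hS => (hy' S hS).2.le, fun S hS => (hy' S hS).1⟩, ?_⟩
    ext S
    change mask k {S | unionOf P S = σ} y S = y S
    rw [mask_apply]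
    split_ifs with h
    · rfl
    · by_contra h'
      exact h (hy' S (Ne.symm h')).2
  proj_filt v hv x hx := by
    ext S
    change mask k {S | unionOf P S = σ} x S = 0
    by_contra h
    have h' := mask_mem _ _ hx S h
    have h1 : unionOf P S = σ := h'.1
    exact Finset.notMem_erase v σ (h'.2 (h1 ▸ hv))
  split v := mask k {S | IsLeast ((σ \ unionOf P S : Finset (Fin m)) : Set (Fin m)) v}
  split_grade v q x hx S hS := (mask_mem _ _ hx S hS).2
  split_filt v τ hv x hx S hS := by
    have h := mask_mem _ _ hx S hS
    have h1 : v ∉ unionOf P S := (Finset.mem_sdiff.1 (Finset.mem_coe.1 h.1.1)).2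
    exact (Finset.subset_insert_iff_of_notMem h1).1 h.2
  sum_split x hx h0 := by
    funext S
    rw [Finset.sum_apply]
    simp only [mask_apply, Set.mem_ofPred_eq]
    by_cases hS : x S = 0
    · simp [hS]
    · refine sum_ite_isLeast Finset.sdiff_subset ?_ _
      rw [Finset.sdiff_nonempty]
      intro h
      have h1 : mask k {S | unionOf P S = σ} x S = 0 := DFunLike.congr_fun h0 S
      rw [mask_apply, if_pos (show S ∈ {S | unionOf P S = σ} from le_antisymm (hx S hS) h)] at h1
      exact hS h1

/-- The homology of `Λ̄^{*,σ}(P)` is the reduced cohomology of the restriction of `K` to `σ`. -/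
theorem nonempty_lambdaHomology_equiv {P : Fin n → Finset (Fin m)} {K : SComplex m}
    (hP : IsSimplicialComplement k P K) (i : ℕ) (σ : Finset (Fin m)) :
    Nonempty (LambdaHomology k P i σ ≃ₗ[k]
      ReducedCohomology k (restriction K σ) (σ.card - i - 1)) := by
  have h := (taylorTop (k := k) (isSimplicialComplement_iff.1 hP)
    σ).nonempty_homology_equiv_reducedCohomology i
  have h1 : ∀ s : ℕ, (taylorTop (k := k) (isSimplicialComplement_iff.1 hP) σ).piece s =
      lambdaPiece k P s σ := fun s => by
    simp [taylorTop, lambdaPiece]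
  have h2 := h1 (i + 1)
  push_cast at h2
  rw [h1, h2] at h
  exact h

end Taylor

/-! ### Dehomogenisation of graded free modules -/

section Dehomogenisation

variable {k : Type u} [Field k] {m : ℕ} {B : Type v}

/-- Dehomogenisation: substitute `1` for all variables. -/
def dehom : (B →₀ MvPolynomial (Fin m) k) →ₗ[k] (B →₀ k) :=
  Finsupp.mapRange.linearMap (MvPolynomial.aeval (R := k) (fun _ : Fin m => (1 : k))).toLinearMap

/-- Homogenisation in degree `a`: the generator `b` is multiplied by the monomial of degree
`a - deg b`. It inverts dehomogenisation when only generators with `deg b ≤ a` are involved; for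
other generators the subtraction is truncated. -/
def homog (deg : B → Fin m →₀ ℕ) (a : Fin m →₀ ℕ) :
    (B →₀ k) →ₗ[k] (B →₀ MvPolynomial (Fin m) k) :=
  Finsupp.linearCombination k fun b => Finsupp.single b (MvPolynomial.monomial (a - deg b) 1)

theorem dehom_apply (w : B →₀ MvPolynomial (Fin m) k) (b : B) :
    dehom w b = MvPolynomial.aeval (R := k) (fun _ : Fin m => (1 : k)) (w b) := rfl

theorem dehom_smul (p : MvPolynomial (Fin m) k) (w : B →₀ MvPolynomial (Fin m) k) :
    dehom (p • w) = MvPolynomial.aeval (R := k) (fun _ : Fin m => (1 : k)) p • dehom w := by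
  ext b
  simp [dehom_apply]

variable (deg : B → Fin m →₀ ℕ) (a : Fin m →₀ ℕ)

theorem homog_apply (x : B →₀ k) (b : B) :
    homog deg a x b = MvPolynomial.monomial (a - deg b) (x b) := by
  induction x using Finsupp.induction_linear with
  | zero => simp
  | add f g hf hg => simp [hf, hg]
  | single b' c =>
    rw [homog, Finsupp.linearCombination_single, Finsupp.smul_single, MvPolynomial.smul_monomial,
      smul_eq_mul, mul_one]
    obtain rfl | h := eq_or_ne b' b
    · simp
    · simp [h.symm]

theorem dehom_homog (x : B →₀ k) : dehom (homog deg a x) = x := by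
  ext b
  simp [dehom_apply, homog_apply, MvPolynomial.aeval_monomial]

variable {deg a}

theorem homog_mem {x : B →₀ k} (hx : x ∈ Finsupp.supported k k {b | deg b ≤ a}) :
    homog deg a x ∈ freePiece k deg a := by
  classical
  intro b e h
  rw [homog_apply, MvPolynomial.coeff_monomial] at h
  split_ifs at h with he
  · have hb : deg b ≤ a := hx (Finsupp.mem_support_iff.2 h)
    rw [← he, add_tsub_cancel_of_le hb]
  · exact absurd rfl h

theorem dehom_mem {w : B →₀ MvPolynomial (Fin m) k} (hw : w ∈ freePiece k deg a) :
    dehom w ∈ Finsupp.supported k k {b | deg b ≤ a} := by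
  rw [Finsupp.mem_supported']
  intro b hb
  have h0 : w b = 0 := by
    by_contra h
    obtain ⟨e, he⟩ := MvPolynomial.ne_zero_iff.1 h
    exact hb (le_iff_exists_add.2 ⟨e, (hw b e he).symm⟩)
  rw [dehom_apply, h0, map_zero]

theorem homog_dehom {w : B →₀ MvPolynomial (Fin m) k} (hw : w ∈ freePiece k deg a) :
    homog deg a (dehom w) = w := by
  classical
  ext1 b
  have h : w b = MvPolynomial.monomial (a - deg b) (MvPolynomial.coeff (a - deg b) (w b)) := by
    ext e
    rw [MvPolynomial.coeff_monomial]
    split_ifs with he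
    · rw [he]
    · by_contra h
      exact he (by rw [← hw b e h, add_tsub_cancel_left])
  rw [homog_apply, dehom_apply]
  nth_rewrite 1 [h]
  nth_rewrite 2 [h]
  simp [MvPolynomial.aeval_monomial]

theorem eq_zero_of_dehom_eq_zero {w : B →₀ MvPolynomial (Fin m) k} (hw : w ∈ freePiece k deg a)
    (h : dehom w = 0) : w = 0 := by
  rw [← homog_dehom hw, h, map_zero]

theorem homog_eq_sum (x : B →₀ k) : homog deg a x =
    ∑ b ∈ x.support, x b • Finsupp.single b (MvPolynomial.monomial (a - deg b) 1) := rfl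

variable {B' : Type*} {deg' : B' → Fin m →₀ ℕ}
  (φ : (B →₀ MvPolynomial (Fin m) k) →ₗ[MvPolynomial (Fin m) k] (B' →₀ MvPolynomial (Fin m) k))

theorem map_mem_freePiece (hφ : ∀ b, φ (Finsupp.single b 1) ∈ freePiece k deg' (deg b))
    {w : B →₀ MvPolynomial (Fin m) k} (hw : w ∈ freePiece k deg a) :
    φ w ∈ freePiece k deg' a := by
  have h1 : φ w = ∑ b ∈ w.support, w b • φ (Finsupp.single b 1) := by
    conv_lhs => rw [← Finsupp.sum_single w, Finsupp.sum, map_sum]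
    refine Finset.sum_congr rfl fun b _ => ?_
    rw [← map_smul, Finsupp.smul_single, smul_eq_mul, mul_one]
  rw [h1]
  refine Submodule.sum_mem _ fun p _ b e h => ?_
  rw [Finsupp.smul_apply, smul_eq_mul, MvPolynomial.coeff_mul] at h
  obtain ⟨⟨e1, e2⟩, he, hne⟩ := Finset.exists_ne_zero_of_sum_ne_zero h
  replace he : e1 + e2 = e := Finset.HasAntidiagonal.mem_antidiagonal.1 he
  have h2 := hw p e1 (left_ne_zero_of_mul hne)
  have h3 := hφ p b e2 (right_ne_zero_of_mul hne)
  rw [← he, ← h2, ← h3]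
  abel

/-- A homogeneous element in the range of a homogeneous map has a homogeneous preimage. -/
theorem exists_mem_freePiece_map_eq (hφ : ∀ b, φ (Finsupp.single b 1) ∈ freePiece k deg' (deg b))
    {y : B' →₀ MvPolynomial (Fin m) k} (hy : y ∈ freePiece k deg' a) (hr : y ∈ LinearMap.range φ) :
    ∃ z ∈ freePiece k deg a, φ z = y := by
  classical
  obtain ⟨z, rfl⟩ := hr
  have htop : z ∈ ⨆ a, freePiece k deg a := by rw [iSup_freePiece]; trivial
  obtain ⟨f, hf, hfz⟩ := (Submodule.mem_iSup_iff_exists_finsupp _ _).1 htop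
  refine ⟨f a, hf a, ?_⟩
  have h := eq_zero_of_sum_freePiece deg' (ι := insert a f.support)
    (fun c => φ (f c) - if c = a then φ z else 0) (fun c => ?_) ?_ (Finset.mem_insert_self a _)
  · rw [if_pos rfl, sub_eq_zero] at h
    exact h
  · refine sub_mem (map_mem_freePiece φ hφ (hf c)) ?_
    split_ifs with hc
    · rwa [hc]
    · exact zero_mem _
  · rw [Finset.sum_sub_distrib, Finset.sum_ite_eq', if_pos (Finset.mem_insert_self a _),
      ← map_sum, sub_eq_zero]
    congr 1
    rw [← hfz]
    exact (Finset.sum_subset (Finset.subset_insert a _) fun c _ hc =>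
      Finsupp.notMem_support_iff.1 hc).symm

/-- The matrix of a map of free modules with `1` substituted for all variables. -/
def dehomMap : (B →₀ k) →ₗ[k] (B' →₀ k) :=
  Finsupp.linearCombination k fun b => dehom (φ (Finsupp.single b 1))

theorem dehomMap_dehom (w : B →₀ MvPolynomial (Fin m) k) :
    dehomMap φ (dehom w) = dehom (φ w) := by
  induction w using Finsupp.induction_linear with
  | zero => simp
  | add f g hf hg => simp [hf, hg]
  | single b p =>
    have h1 : Finsupp.single b p = p • Finsupp.single b (1 : MvPolynomial (Fin m) k) := by
      rw [Finsupp.smul_single, smul_eq_mul, mul_one]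
    have h2 : dehom (k := k) (Finsupp.single b p) =
        Finsupp.single b (MvPolynomial.aeval (R := k) (fun _ : Fin m => (1 : k)) p) :=
      Finsupp.mapRange_single (hf := map_zero _)
    rw [h2, dehomMap, Finsupp.linearCombination_single, h1, map_smul, dehom_smul]

end Dehomogenisation

/-! ### Graded free resolutions -/

namespace GradedFreeResolution

variable {k : Type u} [Field k] {m : ℕ} {K : SComplex m} (F : GradedFreeResolution.{u, v} k K)

theorem exists_augCoeff (b : F.B 0) : ∃ c : k, c • Ideal.Quotient.mk (stanleyReisnerIdeal k K)
    (MvPolynomial.monomial (F.deg 0 b) 1) = F.aug (Finsupp.single b 1) :=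
  Submodule.mem_span_singleton.1 (F.aug_homogeneous b)

/-- The augmentation on the generators: the image of the generator `b` is the multiple by
`augCoeff b` of the monomial of degree `deg b`. -/
def augCoeff (b : F.B 0) : k := (F.exists_augCoeff b).choose

/-- The dehomogenised augmentation. -/
def dehomAug : (F.B 0 →₀ k) →ₗ[k] k := Finsupp.linearCombination k F.augCoeff

theorem aug_homog {a : Fin m →₀ ℕ} {x : F.B 0 →₀ k}
    (hx : x ∈ Finsupp.supported k k {b | F.deg 0 b ≤ a}) :
    F.aug (homog (F.deg 0) a x) = F.dehomAug x •
      Ideal.Quotient.mk (stanleyReisnerIdeal k K) (MvPolynomial.monomial a 1) := by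
  rw [homog_eq_sum, map_sum, dehomAug, Finsupp.linearCombination_apply, Finsupp.sum,
    Finset.sum_smul]
  refine Finset.sum_congr rfl fun b hb => ?_
  have hb' : F.deg 0 b ≤ a := hx hb
  have h1 : (Finsupp.single b (MvPolynomial.monomial (a - F.deg 0 b) 1) : F.B 0 →₀ _) =
      MvPolynomial.monomial (a - F.deg 0 b) (1 : k) •
        (Finsupp.single b 1 : _ →₀ MvPolynomial (Fin m) k) := by
    rw [Finsupp.smul_single, smul_eq_mul, mul_one]
  rw [← algebraMap_smul (MvPolynomial (Fin m) k) (x b), map_smul, h1, map_smul,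
    ← (F.exists_augCoeff b).choose_spec, algebraMap_smul, smul_eq_mul, mul_smul]
  congr 1
  rw [smul_comm]
  congr 1
  change Ideal.Quotient.mk _ (MvPolynomial.monomial (a - F.deg 0 b) (1 : k) •
    MvPolynomial.monomial (F.deg 0 b) 1) = _
  rw [smul_eq_mul, MvPolynomial.monomial_mul, mul_one, tsub_add_cancel_of_le hb']

theorem aug_eq {a : Fin m →₀ ℕ} {w : F.B 0 →₀ MvPolynomial (Fin m) k}
    (hw : w ∈ freePiece k (F.deg 0) a) :
    F.aug w = F.dehomAug (dehom w) •
      Ideal.Quotient.mk (stanleyReisnerIdeal k K) (MvPolynomial.monomial a 1) := by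
  rw [← F.aug_homog (dehom_mem hw), homog_dehom hw]

theorem d_mem {s : ℕ} {a : Fin m →₀ ℕ} {w : F.B (s + 1) →₀ MvPolynomial (Fin m) k}
    (hw : w ∈ freePiece k (F.deg (s + 1)) a) : F.d s w ∈ freePiece k (F.deg s) a :=
  map_mem_freePiece _ (F.d_homogeneous s) hw

/-- A homogeneous element of degree `a` in the range of a differential has a preimage among the
generators of degree at most `a`. -/
theorem exists_dehomMap_eq {s : ℕ} {a : Fin m →₀ ℕ} {x : F.B s →₀ k}
    (hx : x ∈ Finsupp.supported k k {b | F.deg s b ≤ a})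
    (hr : homog (F.deg s) a x ∈ LinearMap.range (F.d s)) :
    ∃ y ∈ Finsupp.supported k k {b | F.deg (s + 1) b ≤ a}, dehomMap (F.d s) y = x := by
  obtain ⟨z, hz, hzx⟩ := exists_mem_freePiece_map_eq _ (F.d_homogeneous s) (homog_mem hx) hr
  exact ⟨dehom z, dehom_mem hz, by rw [dehomMap_dehom, hzx, dehom_homog]⟩

theorem dehomMap_mem {s : ℕ} {a : Fin m →₀ ℕ} {x : F.B (s + 1) →₀ k}
    (hx : x ∈ Finsupp.supported k k {b | F.deg (s + 1) b ≤ a}) :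
    dehomMap (F.d s) x ∈ Finsupp.supported k k {b | F.deg s b ≤ a} := by
  rw [← dehom_homog (F.deg (s + 1)) a x, dehomMap_dehom]
  exact dehom_mem (F.d_mem (homog_mem hx))

theorem dehomMap_dehomMap (s : ℕ) (x : F.B (s + 2) →₀ k) :
    dehomMap (F.d s) (dehomMap (F.d (s + 1)) x) = 0 := by
  -- Any lift along the substitution will do; the degree `0` is arbitrary.
  rw [← dehom_homog (F.deg (s + 2)) 0 x, dehomMap_dehom, dehomMap_dehom]
  have h : F.d (s + 1) (homog (F.deg (s + 2)) 0 x) ∈ LinearMap.ker (F.d s) := by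
    rw [← F.exact_succ]
    exact ⟨_, rfl⟩
  rw [LinearMap.mem_ker.1 h, map_zero]

theorem mk_monomial_eq_zero_iff {a : Fin m →₀ ℕ} :
    Ideal.Quotient.mk (stanleyReisnerIdeal k K) (MvPolynomial.monomial a 1) = 0 ↔
      a.support ∉ K := by
  rw [Ideal.Quotient.eq_zero_iff_mem, monomial_mem_stanleyReisnerIdeal]

theorem dehomAug_dehomMap {τ : Finset (Fin m)} (hτ : τ ∈ K) {x : F.B 1 →₀ k}
    (hx : x ∈ Finsupp.supported k k {b | F.deg 1 b ≤ expVec τ}) :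
    F.dehomAug (dehomMap (F.d 0) x) = 0 := by
  have h := F.aug_eq (F.d_mem (homog_mem hx))
  have h1 : F.d 0 (homog (F.deg 1) (expVec τ) x) ∈ LinearMap.ker F.aug := by
    rw [← F.exact_zero]
    exact ⟨_, rfl⟩
  rw [LinearMap.mem_ker.1 h1, ← dehomMap_dehom, dehom_homog, eq_comm, smul_eq_zero,
    mk_monomial_eq_zero_iff, support_expVec] at h
  exact h.resolve_right (not_not_intro hτ)

theorem exists_dehomAug_eq_one {τ : Finset (Fin m)} (hτ : τ ∈ K) :
    ∃ x ∈ Finsupp.supported k k {b | F.deg 0 b ≤ expVec τ}, F.dehomAug x = 1 := by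
  classical
  obtain ⟨w, hw⟩ := F.aug_surjective
    (Ideal.Quotient.mk (stanleyReisnerIdeal k K) (MvPolynomial.monomial (expVec τ) 1))
  have htop : w ∈ ⨆ a, freePiece k (F.deg 0) a := by rw [iSup_freePiece]; trivial
  obtain ⟨f, hf, rfl⟩ := (Submodule.mem_iSup_iff_exists_finsupp _ _).1 htop
  refine ⟨dehom (f (expVec τ)), dehom_mem (hf _), ?_⟩
  have h1 : F.aug (f.sum fun _ x => x) = Ideal.Quotient.mk (stanleyReisnerIdeal k K)
      (∑ a ∈ f.support, MvPolynomial.monomial a (F.dehomAug (dehom (f a)))) := by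
    rw [Finsupp.sum, map_sum, map_sum]
    refine Finset.sum_congr rfl fun a _ => ?_
    rw [F.aug_eq (hf a), ← mul_one (F.dehomAug (dehom (f a))), ← smul_eq_mul,
      ← MvPolynomial.smul_monomial, smul_eq_mul, mul_one]
    rfl
  rw [h1, Ideal.Quotient.eq, mem_stanleyReisnerIdeal] at hw
  have h2 := mt (hw (expVec τ)) (by rw [support_expVec]; exact not_not_intro hτ)
  rw [MvPolynomial.notMem_support_iff, MvPolynomial.coeff_sub, MvPolynomial.coeff_sum,
    MvPolynomial.coeff_monomial, if_pos rfl, sub_eq_zero] at h2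
  simp only [MvPolynomial.coeff_monomial, Finset.sum_ite_eq'] at h2
  split_ifs at h2
  · exact h2
  · exact absurd h2 zero_ne_one

/-- The dehomogenised resolution as a filtered resolution of the squarefree degrees. -/
def filteredResolution : FilteredResolution k K (∀ s, F.B s →₀ k) where
  d := LinearMap.pi fun s => dehomMap (F.d s) ∘ₗ LinearMap.proj (s + 1)
  d_d x := funext fun s => F.dehomMap_dehomMap s (x (s + 2))
  grade q :=
    { carrier := {x | ∀ s : ℕ, (s : ℤ) ≠ q → x s = 0}
      add_mem' := fun hx hy s h => by simp [hx s h, hy s h]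
      zero_mem' := fun s _ => rfl
      smul_mem' := fun c x hx s h => by simp [hx s h] }
  d_grade q x hx s hs := by
    change dehomMap (F.d s) (x (s + 1)) = 0
    rw [hx (s + 1) (by push_cast; lia), map_zero]
  filt τ := Submodule.pi Set.univ fun s => Finsupp.supported k k {b | F.deg s b ≤ expVec τ}
  filt_mono τ τ' h x hx s hs :=
    Finsupp.supported_mono (fun b hb => le_trans hb (expVec_le_expVec.2 h)) (hx s hs)
  d_filt τ x hx s _ := F.dehomMap_mem (hx (s + 1) trivial)
  aug := F.dehomAug ∘ₗ LinearMap.proj 0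
  aug_grade q hq x hx := by
    change F.dehomAug (x 0) = 0
    rw [hx 0 (by simpa using hq.symm), map_zero]
  aug_d τ hτ x hx := F.dehomAug_dehomMap hτ (hx 1 trivial)
  exists_aug_eq_one τ hτ := by
    classical
    obtain ⟨x, hx, h1⟩ := F.exists_dehomAug_eq_one hτ
    refine ⟨Pi.single 0 x, ⟨fun s _ => ?_, fun s hs => ?_⟩, ?_⟩
    · obtain rfl | h := eq_or_ne s 0
      · rwa [Pi.single_eq_same]
      · rw [Pi.single_eq_of_ne h]
        exact zero_mem _
    · exact Pi.single_eq_of_ne (by simpa using hs) _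
    · change F.dehomAug ((Pi.single 0 x : ∀ s, F.B s →₀ k) 0) = 1
      rw [Pi.single_eq_same, h1]
  exact τ q x hx hd h0 := by
    classical
    by_cases hq : ∃ s : ℕ, (s : ℤ) = q
    · obtain ⟨s, rfl⟩ := hq
      have hr : homog (F.deg s) (expVec τ) (x s) ∈ LinearMap.range (F.d s) := by
        cases s with
        | zero =>
          rw [F.exact_zero, LinearMap.mem_ker, F.aug_homog (hx.1 0 trivial), smul_eq_zero,
            mk_monomial_eq_zero_iff, support_expVec, or_iff_not_imp_right, not_not]
          exact h0
        | succ t =>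
          rw [F.exact_succ, LinearMap.mem_ker]
          have hm := homog_mem (hx.1 (t + 1) trivial)
          refine eq_zero_of_dehom_eq_zero (F.d_mem hm) ?_
          rw [← dehomMap_dehom, dehom_homog]
          exact congrFun hd t
      obtain ⟨y, hy, hyx⟩ := F.exists_dehomMap_eq (hx.1 s trivial) hr
      refine ⟨Pi.single (s + 1) y, ⟨fun t _ => ?_, fun t ht => ?_⟩, ?_, ?_⟩
      · obtain rfl | h := eq_or_ne t (s + 1)
        · rwa [Pi.single_eq_same]
        · rw [Pi.single_eq_of_ne h]
          exact zero_mem _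
      · exact Pi.single_eq_of_ne (by rintro rfl; exact ht (by push_cast; rfl)) _
      · change F.dehomAug ((Pi.single (s + 1) y : ∀ s, F.B s →₀ k) 0) = 0
        rw [Pi.single_eq_of_ne (Nat.succ_ne_zero s).symm, map_zero]
      · funext t
        change dehomMap (F.d t) ((Pi.single (s + 1) y : ∀ s, F.B s →₀ k) (t + 1)) = x t
        obtain rfl | h := eq_or_ne t s
        · rw [Pi.single_eq_same, hyx]
        · rw [Pi.single_eq_of_ne (by simpa using h), map_zero, hx.2 t (by simpa using h)]
    · refine ⟨0, zero_mem _, map_zero _, ?_⟩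
      rw [map_zero, eq_comm]
      exact funext fun s => hx.2 s fun h => hq ⟨s, h⟩

/-! ### Reduction modulo the variables -/

/-- Reduction of a homogeneous element of degree `a` modulo the variables: only the generators of
degree exactly `a` survive. -/
def reduce (s : ℕ) (a : Fin m →₀ ℕ) : (F.B s →₀ k) →ₗ[k] F.Tensored s :=
  open Classical in
  Finsupp.linearCombination k fun b =>
    if F.deg s b = a then Finsupp.single b 1 ⊗ₜ[MvPolynomial (Fin m) k] 1 else 0

theorem smul_one_trivialModule (p : MvPolynomial (Fin m) k) : p • (1 : TrivialModule k m) =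
    Ideal.Quotient.mk (Ideal.span (Set.range MvPolynomial.X)) p := by
  change Ideal.Quotient.mk _ (p • 1) = _
  rw [smul_eq_mul, mul_one]

theorem monomial_smul_one_trivialModule {e : Fin m →₀ ℕ} (he : e ≠ 0) :
    MvPolynomial.monomial e (1 : k) • (1 : TrivialModule k m) = 0 := by
  rw [smul_one_trivialModule, Ideal.Quotient.eq_zero_iff_mem]
  obtain ⟨v, hv⟩ := Finsupp.ne_iff.1 he
  rw [Finsupp.coe_zero, Pi.zero_apply] at hv
  have h1 : e = Finsupp.single v 1 + (e - Finsupp.single v 1) := by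
    rw [add_tsub_cancel_of_le]
    exact Finsupp.single_le_iff.2 (Nat.one_le_iff_ne_zero.2 hv)
  rw [h1, ← one_mul (1 : k), ← MvPolynomial.monomial_mul]
  exact Ideal.mul_mem_right _ _ (Ideal.subset_span ⟨v, rfl⟩)

theorem reduce_eq {s : ℕ} {a : Fin m →₀ ℕ} {x : F.B s →₀ k}
    (hx : x ∈ Finsupp.supported k k {b | F.deg s b ≤ a}) :
    F.reduce s a x = homog (F.deg s) a x ⊗ₜ[MvPolynomial (Fin m) k] (1 : TrivialModule k m) := by
  rw [homog_eq_sum, TensorProduct.sum_tmul, reduce, Finsupp.linearCombination_apply, Finsupp.sum]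
  refine Finset.sum_congr rfl fun b hb => ?_
  have hb' : F.deg s b ≤ a := hx hb
  rw [← TensorProduct.smul_tmul']
  congr 1
  split_ifs with h
  · rw [h, tsub_self]
    rfl
  · have h1 : (Finsupp.single b (MvPolynomial.monomial (a - F.deg s b) 1) : F.B s →₀ _) =
        MvPolynomial.monomial (a - F.deg s b) (1 : k) •
          (Finsupp.single b 1 : _ →₀ MvPolynomial (Fin m) k) := by
      rw [Finsupp.smul_single, smul_eq_mul, mul_one]
    rw [h1, TensorProduct.smul_tmul, monomial_smul_one_trivialModule, TensorProduct.tmul_zero]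
    exact fun h' => h (le_antisymm hb' (tsub_eq_zero_iff_le.1 h'))

theorem reduce_dehom {s : ℕ} {a : Fin m →₀ ℕ} {w : F.B s →₀ MvPolynomial (Fin m) k}
    (hw : w ∈ freePiece k (F.deg s) a) :
    F.reduce s a (dehom w) = w ⊗ₜ[MvPolynomial (Fin m) k] (1 : TrivialModule k m) := by
  rw [F.reduce_eq (dehom_mem hw), homog_dehom hw]

theorem reduce_mem {s : ℕ} {a : Fin m →₀ ℕ} {x : F.B s →₀ k}
    (hx : x ∈ Finsupp.supported k k {b | F.deg s b ≤ a}) : F.reduce s a x ∈ F.tensoredPiece s a :=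
  Submodule.subset_span ⟨_, homog_mem hx, F.reduce_eq hx⟩

theorem reduce_dehomMap {s : ℕ} {a : Fin m →₀ ℕ} {x : F.B (s + 1) →₀ k}
    (hx : x ∈ Finsupp.supported k k {b | F.deg (s + 1) b ≤ a}) :
    F.reduce s a (dehomMap (F.d s) x) = F.tensoredD s (F.reduce (s + 1) a x) := by
  rw [F.reduce_eq hx]
  conv_lhs => rw [← dehom_homog (F.deg (s + 1)) a x, dehomMap_dehom]
  rw [F.reduce_dehom (F.d_mem (homog_mem hx))]
  rfl

theorem exists_reduce_eq {s : ℕ} {a : Fin m →₀ ℕ} {t : F.Tensored s}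
    (ht : t ∈ F.tensoredPiece s a) :
    ∃ x ∈ Finsupp.supported k k {b | F.deg s b ≤ a}, F.reduce s a x = t := by
  have h : F.tensoredPiece s a ≤
      (Finsupp.supported k k {b | F.deg s b ≤ a}).map (F.reduce s a) := by
    rw [tensoredPiece, Submodule.span_le]
    rintro _ ⟨w, hw, rfl⟩
    exact ⟨dehom w, dehom_mem hw, F.reduce_dehom hw⟩
  exact h ht

theorem eq_zero_of_reduce_eq_zero {s : ℕ} {a : Fin m →₀ ℕ} {x : F.B s →₀ k}
    (hx : x ∈ Finsupp.supported k k {b | F.deg s b ≤ a}) (h0 : F.reduce s a x = 0) {b : F.B s}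
    (hb : F.deg s b = a) : x b = 0 := by
  classical
  rw [F.reduce_eq hx] at h0
  have h1 := congrArg (fun t => TensorProduct.finsuppScalarLeft (MvPolynomial (Fin m) k)
    (TrivialModule k m) (F.B s) t b) h0
  simp only [TensorProduct.finsuppScalarLeft_apply_tmul_apply, map_zero, Finsupp.coe_zero,
    Pi.zero_apply, homog_apply, hb, tsub_self] at h1
  rw [smul_one_trivialModule, Ideal.Quotient.eq_zero_iff_mem] at h1
  have h2 : Ideal.span (Set.range MvPolynomial.X) ≤
      RingHom.ker (MvPolynomial.constantCoeff (σ := Fin m) (R := k)) := by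
    rw [Ideal.span_le]
    rintro _ ⟨v, rfl⟩
    simp [RingHom.mem_ker]
  simpa [RingHom.mem_ker] using h2 h1

open Classical in
/-- The part of `F ⊗ k` in the multidegree of `σ` is the top quotient of the dehomogenised
resolution at `σ`. -/
def top (σ : Finset (Fin m)) : F.filteredResolution.Top σ (∀ s, F.Tensored s) where
  d := LinearMap.pi fun s => F.tensoredD s ∘ₗ LinearMap.proj (s + 1)
  piece q :=
    { carrier := {g | ∀ s : ℕ, g s ∈ F.tensoredPiece s (expVec σ) ∧ ((s : ℤ) ≠ q → g s = 0)}
      add_mem' := fun hx hy s => ⟨add_mem (hx s).1 (hy s).1,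
        fun h => by simp [(hx s).2 h, (hy s).2 h]⟩
      zero_mem' := fun s => ⟨zero_mem _, fun _ => rfl⟩
      smul_mem' := fun c x hx s => ⟨Submodule.smul_mem _ c (hx s).1,
        fun h => by simp [(hx s).2 h]⟩ }
  proj := LinearMap.pi fun s => F.reduce s (expVec σ) ∘ₗ LinearMap.proj s
  proj_mem q x hx s := ⟨F.reduce_mem (hx.1 s trivial), fun h => by
    change F.reduce s (expVec σ) (x s) = 0
    rw [hx.2 s h, map_zero]⟩
  proj_d x hx := funext fun s => F.reduce_dehomMap (hx (s + 1) trivial)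
  proj_surj q y hy := by
    choose x hx hxy using fun s => F.exists_reduce_eq (hy s).1
    refine ⟨fun s => if (s : ℤ) = q then x s else 0, ⟨fun s _ => ?_, fun s hs => if_neg hs⟩, ?_⟩
    · dsimp only
      split_ifs
      · exact hx s
      · exact zero_mem _
    · funext s
      change F.reduce s (expVec σ) (if (s : ℤ) = q then x s else 0) = y s
      split_ifs with h
      · exact hxy s
      · rw [map_zero, (hy s).2 h]
  proj_filt v hv x hx := by
    funext s
    change F.reduce s (expVec σ) (x s) = 0
    rw [reduce, Finsupp.linearCombination_apply, Finsupp.sum]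
    refine Finset.sum_eq_zero fun b hb => ?_
    rw [if_neg, smul_zero]
    intro h
    have h1 : F.deg s b ≤ expVec (σ.erase v) := hx s trivial hb
    rw [h, expVec_le_expVec] at h1
    exact Finset.notMem_erase v σ (h1 hv)
  split v := LinearMap.pi fun s => Finsupp.linearCombination k (fun b =>
    if IsLeast ((σ \ (F.deg s b).support : Finset (Fin m)) : Set (Fin m)) v then
      Finsupp.single b 1 else 0) ∘ₗ LinearMap.proj s
  split_grade v q x hx s hs := by
    change Finsupp.linearCombination k _ (x s) = 0
    rw [hx s hs, map_zero]
  split_filt v τ hv x hx s _ := by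
    change Finsupp.linearCombination k _ (x s) ∈ _
    rw [Finsupp.linearCombination_apply]
    refine sum_mem fun b hb => Submodule.smul_mem _ _ ?_
    split_ifs with h
    · refine Finsupp.single_mem_supported k _ ?_
      have h1 : F.deg s b ≤ expVec (insert v τ) := hx s trivial hb
      have h2 : F.deg s b v = 0 := by
        have := (Finset.mem_sdiff.1 (Finset.mem_coe.1 h.1)).2
        rwa [Finsupp.notMem_support_iff] at this
      intro w
      obtain rfl | hw := eq_or_ne w v
      · rw [h2]; exact Nat.zero_le _
      · have h3 := h1 w
        rw [expVec_apply] at h3 ⊢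
        simpa [hw] using h3
    · exact zero_mem _
  sum_split x hx h0 := by
    funext s
    rw [Finset.sum_apply]
    change ∑ v ∈ σ, Finsupp.linearCombination k _ (x s) = x s
    simp only [Finsupp.linearCombination_apply, Finsupp.sum]
    rw [Finset.sum_comm]
    conv_rhs => rw [← Finsupp.sum_single (x s), Finsupp.sum]
    refine Finset.sum_congr rfl fun b hb => ?_
    rw [← Finset.smul_sum, sum_ite_isLeast Finset.sdiff_subset, Finsupp.smul_single, smul_eq_mul,
      mul_one]
    rw [Finset.sdiff_nonempty, ← expVec_le_iff]
    intro h
    exact Finsupp.mem_support_iff.1 hb (F.eq_zero_of_reduce_eq_zero (hx s trivial)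
      (congrFun h0 s) (le_antisymm (hx s trivial hb) h))

theorem nonempty_homology_top_equiv_tor (σ : Finset (Fin m)) (i : ℕ) :
    Nonempty (Subquotient (k := k) (V := ∀ s, F.Tensored s)
      ((F.top σ).piece i ⊓ LinearMap.ker (F.top σ).d)
      (((F.top σ).piece (i + 1)).map (F.top σ).d) ≃ₗ[k] F.Tor i (expVec σ)) := by
  classical
  have hd : ∀ g s, (F.top σ).d g s = F.tensoredD s (g (s + 1)) := fun _ _ => rfl
  have hsingle : ∀ (j : ℕ) (z : F.Tensored j), z ∈ F.tensoredPiece j (expVec σ) →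
      Pi.single j z ∈ (F.top σ).piece j := by
    intro j z hz s
    obtain rfl | h := eq_or_ne s j
    · rw [Pi.single_eq_same]
      exact ⟨hz, fun h => absurd rfl h⟩
    · rw [Pi.single_eq_of_ne h]
      exact ⟨zero_mem _, fun _ => rfl⟩
  refine nonempty_subquotient_equiv _ _ _ _ (LinearMap.proj i) ?_ ?_ ?_ ?_
  · rintro g ⟨hg, hg0⟩
    cases i with
    | zero => exact (hg 0).1
    | succ t => exact ⟨(hg (t + 1)).1, congrFun hg0 t⟩
  · rintro _ _ ⟨g, hg, rfl⟩
    exact ⟨g (i + 1), (hg (i + 1)).1, rfl⟩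
  · intro z hz
    refine ⟨Pi.single i z, ⟨hsingle i z ?_, ?_⟩, ?_⟩
    · cases i with
      | zero => exact hz
      | succ t => exact hz.1
    · change (F.top σ).d (Pi.single i z) = 0
      funext s
      rw [hd]
      obtain rfl | h := eq_or_ne (s + 1) i
      · rw [Pi.single_eq_same]
        exact hz.2
      · rw [Pi.single_eq_of_ne h, map_zero]
        rfl
    · rw [LinearMap.proj_apply, Pi.single_eq_same, sub_self]
      exact zero_mem _
  · rintro g ⟨hg, -⟩ ⟨w, hw, hwg⟩
    refine ⟨Pi.single (i + 1) w, by exact_mod_cast hsingle (i + 1) w hw, ?_⟩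
    funext s
    rw [hd]
    obtain rfl | h := eq_or_ne s i
    · rw [Pi.single_eq_same]
      exact hwg
    · rw [Pi.single_eq_of_ne (by simpa using h), map_zero, (hg s).2 (by simpa using h)]

/-- The multigraded Tor in the degree of `σ` is the reduced cohomology of the restriction of `K` to
`σ`. -/
theorem nonempty_tor_equiv (i : ℕ) (σ : Finset (Fin m)) :
    Nonempty (F.Tor i (expVec σ) ≃ₗ[k]
      ReducedCohomology k (restriction K σ) (σ.card - i - 1)) := by
  obtain ⟨e1⟩ := F.nonempty_homology_top_equiv_tor σ i
  obtain ⟨e2⟩ := (F.top σ).nonempty_homology_equiv_reducedCohomology i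
  exact ⟨e1.symm.trans e2⟩

end GradedFreeResolution

/-! ### Stars and links -/

theorem restriction_star {m : ℕ} (K : SComplex m) (ω : Finset (Fin m)) :
    restriction (star K ω) (Finset.univ \ ω) = link K ω := by
  ext τ
  change (τ ∈ K ∧ ω ∪ τ ∈ K) ∧ τ ⊆ Finset.univ \ ω ↔ τ ∈ K ∧ ω ∪ τ ∈ K ∧ Disjoint ω τ
  rw [Finset.subset_sdiff, disjoint_comm (a := τ), and_assoc]
  simp

end

end SimplicialComplement

theorem theorem2p9 {k : Type u} [Field k] {m n : ℕ} (K : SimplicialComplement.SComplex m)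
    (P : Fin n → Finset (Fin m)) (hP : SimplicialComplement.IsSimplicialComplement k P K)
    (ω : Finset (Fin m)) :
    SimplicialComplement.IsSimplicialComplement k (SimplicialComplement.compression ω P)
        (SimplicialComplement.star K ω) ∧
      (ω ∈ K → ∀ j, (SimplicialComplement.compression ω P j).Nonempty) ∧
      (∀ (F : SimplicialComplement.GradedFreeResolution.{u, v} k (SimplicialComplement.star K ω))
          (i : ℕ) (σ : Finset (Fin m)),
        Nonempty
          (SimplicialComplement.LambdaHomology k (SimplicialComplement.compression ω P) i σ ≃ₗ[k]
            F.Tor i (SimplicialComplement.expVec σ))) ∧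
      (∀ q : ℕ,
        Nonempty
          (SimplicialComplement.LambdaHomology k (SimplicialComplement.compression ω P) q
              (Finset.univ \ ω) ≃ₗ[k]
            SimplicialComplement.ReducedCohomology k (SimplicialComplement.link K ω)
              ((m : ℤ) - ω.card - q - 1))) := by
  refine ⟨SimplicialComplement.isSimplicialComplement_compression hP ω,
    fun hω j => SimplicialComplement.compression_nonempty hP hω j, fun F i σ => ?_, fun q => ?_⟩
  · obtain ⟨e1⟩ := SimplicialComplement.nonempty_lambdaHomology_equiv
      (SimplicialComplement.isSimplicialComplement_compression hP ω) i σ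
    obtain ⟨e2⟩ := F.nonempty_tor_equiv i σ
    exact ⟨e1.trans e2.symm⟩
  · have h := SimplicialComplement.nonempty_lambdaHomology_equiv
      (SimplicialComplement.isSimplicialComplement_compression hP ω) q (Finset.univ \ ω)
    have hc : ((Finset.univ \ ω).card : ℤ) = m - ω.card := by
      have h1 := Finset.card_sdiff_add_card_eq_card (Finset.subset_univ ω)
      rw [Finset.card_univ, Fintype.card_fin] at h1
      lia
    rwa [SimplicialComplement.restriction_star, hc] at h
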